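/- Let $\Omega$ be a separable metric space with its Borel $\sigma$-algebra, let $\tau=(\tau_a)_{a\in\mathbb R}$ be a continuous action of $\mathbb R$ on $\Omega$, and let $\mathbb P$ be a $\tau$-invariant probability measure on $\Omega$ that is positive on nonempty open sets and ergodic (a Borel set $A$ with $\tau_aA=A$ for all $a$ has $\mathbb P(A)\in\{0,1\}$). Let $\bar K:\Omega\times[-1,1]\to\mathbb R$ be measurable, put $K(q,p;\omega)=\bar K(\tau_q\omega,p)$ for $(q,p)\in\mathcal S=\mathbb R\times[-1,1]$, and assume that $\bar K$ is $C^1$ in the sense that for almost every $\omega$ the function $K(\cdot,\cdot\,;\omega)$ is $C^1$ on $\mathcal S$, up to the boundary. Assume that, for almost every $\omega$, $K_p(q,1;\omega)<0$ and $K_p(q,-1;\omega)>0$ for all $q\in\mathbb R$ (in particular this holds if $\mp\bar K_p(\omega,\pm1)>0$ for every $\omega\in\Omega$). Call $(q,p)\in\mathcal S$ critical for $K(\cdot,\cdot\,;\omega)$ if $K_q=K_p=0$ there, and call a critical point a saddle point if it is neither a local maximum nor a local minimum of $K(\cdot,\cdot\,;\omega)$ on $\mathcal S$. Then: (a) almost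 surely $K(\cdot,\cdot\,;\omega)$ has infinitely many critical points; (b) one of the following holds: (1) almost surely $K(\cdot,\cdot\,;\omega)$ has a continuum of critical points, of the form $\{(q,a(q)) : q\in\mathbb R\}$ for some function $a=a_\omega:\mathbb R\to[-1,1]$ (not necessarily continuous); or (2) almost surely $K(\cdot,\cdot\,;\omega)$ has infinitely many critical points that are local maxima, and infinitely many critical points that are saddle points or local minima, and are not also local maxima. -/

import Mathlib

open Set MeasureTheory

namespace RandomTwist

/-- The strip `ℝ × [-1, 1]`, with coordinates `(q, p)`. -/
def strip : Set (ℝ × ℝ) := univ ×ˢ Icc (-1) 1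

/-- `P` is a `τ`-invariant ergodic probability measure that charges every nonempty open set;
`τ` is a continuous action of `ℝ` on `Ω`. -/
structure IsInvariantErgodic {Ω : Type*} [TopologicalSpace Ω] [MeasurableSpace Ω]
    (τ : Flow ℝ Ω) (P : Measure Ω) : Prop where
  prob : P univ = 1
  pos : ∀ U : Set Ω, IsOpen U → U.Nonempty → 0 < P U
  invariant : ∀ (a : ℝ) (A : Set Ω), MeasurableSet A → P (τ a '' A) = P A
  ergodic : ∀ A : Set Ω, MeasurableSet A → (∀ a : ℝ, τ a '' A = A) → P A = 1 ∨ P A = 0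

/-- The realization `K(q, p; ω) = Kbar(τ_q ω, p)`. Only the values of `Kbar` on `Ω × [-1, 1]`
are ever used, since realizations are only considered on the strip. -/
def realization {Ω : Type*} [TopologicalSpace Ω] (τ : Flow ℝ Ω) (Kbar : Ω → ℝ → ℝ) (ω : Ω) :
    ℝ × ℝ → ℝ :=
  fun x => Kbar (τ x.1 ω) x.2

/-- `Kbar : Ω × [-1, 1] → ℝ` is measurable and, for almost every `ω`, has continuous partial
derivatives in the direction of the flow and in `p`, up to the boundary: the realization is
`C¹` on the closed strip. -/
structure IsC1 {Ω : Type*} [TopologicalSpace Ω] [MeasurableSpace Ω]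
    (τ : Flow ℝ Ω) (P : Measure Ω) (Kbar : Ω → ℝ → ℝ) : Prop where
  measurable : Measurable fun x : Ω × Icc (-1 : ℝ) 1 => Kbar x.1 x.2
  contDiffOn : ∀ᵐ ω ∂P, ContDiffOn ℝ 1 (realization τ Kbar ω) strip

/-- `x` is a critical point of `f : ℝ × [-1, 1] → ℝ`. -/
def IsCritical (f : ℝ × ℝ → ℝ) (x : ℝ × ℝ) : Prop :=
  x ∈ strip ∧ HasFDerivWithinAt f (0 : ℝ × ℝ →L[ℝ] ℝ) strip x

/-- Critical points that are local maxima of `f` on the strip. -/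
def IsCriticalMax (f : ℝ × ℝ → ℝ) (x : ℝ × ℝ) : Prop :=
  IsCritical f x ∧ IsLocalMaxOn f strip x

/-- Critical points that are local minima of `f` on the strip. -/
def IsCriticalMin (f : ℝ × ℝ → ℝ) (x : ℝ × ℝ) : Prop :=
  IsCritical f x ∧ IsLocalMinOn f strip x

/-- Saddle points: critical points that are neither local maxima nor local minima. -/
def IsSaddle (f : ℝ × ℝ → ℝ) (x : ℝ × ℝ) : Prop :=
  IsCritical f x ∧ ¬ IsLocalMaxOn f strip x ∧ ¬ IsLocalMinOn f strip x

/-- `f` has a continuum of critical points, of the form `{(q, a(q)) | q ∈ ℝ}`. No continuity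
of `a` is asked for. -/
def HasContinuumOfCriticalPoints (f : ℝ × ℝ → ℝ) : Prop :=
  ∃ a : ℝ → ℝ, ∀ q : ℝ, IsCritical f (q, a q)

end RandomTwist

namespace RandomTwist

open Filter Topology

/-! ### The gradient on the strip -/

lemma convex_strip : Convex ℝ strip := convex_univ.prod (convex_Icc _ _)

lemma isClosed_strip : IsClosed strip := isClosed_univ.prod isClosed_Icc

lemma mem_strip {x : ℝ × ℝ} : x ∈ strip ↔ -1 ≤ x.2 ∧ x.2 ≤ 1 := by simp [strip]

lemma uniqueDiffOn_strip : UniqueDiffOn ℝ strip :=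
  uniqueDiffOn_univ.prod (uniqueDiffOn_Icc (by norm_num))

/-- The gradient of a function on the strip, computed within the strip. -/
noncomputable def grad (f : ℝ × ℝ → ℝ) (x : ℝ × ℝ) : ℝ × ℝ :=
  (fderivWithin ℝ f strip x (1, 0), fderivWithin ℝ f strip x (0, 1))

/-- The gradient points into the strip along its boundary. -/
def IsInward (f : ℝ × ℝ → ℝ) : Prop :=
  ∀ q : ℝ, (grad f (q, 1)).2 < 0 ∧ 0 < (grad f (q, -1)).2

lemma fderivWithin_apply_eq_grad (f : ℝ × ℝ → ℝ) (x v : ℝ × ℝ) :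
    fderivWithin ℝ f strip x v = v.1 * (grad f x).1 + v.2 * (grad f x).2 := by
  have : v = v.1 • ((1 : ℝ), (0 : ℝ)) + v.2 • ((0 : ℝ), (1 : ℝ)) := by ext <;> simp
  conv_lhs => rw [this]
  rw [map_add, map_smul, map_smul]
  rfl

lemma grad_eq_zero_iff {f : ℝ × ℝ → ℝ} {x : ℝ × ℝ} :
    grad f x = 0 ↔ fderivWithin ℝ f strip x = 0 := by
  constructor
  · intro h
    ext <;> simp [fderivWithin_apply_eq_grad, h]
  · intro h
    simp [grad, h]

lemma continuousOn_grad {f : ℝ × ℝ → ℝ} (hf : ContDiffOn ℝ 1 f strip) :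
    ContinuousOn (grad f) strip := by
  have h := hf.continuousOn_fderivWithin uniqueDiffOn_strip le_rfl
  exact (h.clm_apply continuousOn_const).prodMk (h.clm_apply continuousOn_const)

lemma isCritical_iff {f : ℝ × ℝ → ℝ} (hf : ContDiffOn ℝ 1 f strip) {x : ℝ × ℝ}
    (hx : x ∈ strip) : IsCritical f x ↔ grad f x = 0 := by
  rw [grad_eq_zero_iff]
  constructor
  · rintro ⟨-, h⟩
    exact h.fderivWithin (uniqueDiffOn_strip x hx)
  · intro h
    refine ⟨hx, ?_⟩
    rw [← h]
    exact ((hf.differentiableOn one_ne_zero) x hx).hasFDerivWithinAt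

/-- A local maximum on the strip of a function with inward gradient is a critical point. -/
lemma isCritical_of_isLocalMaxOn {f : ℝ × ℝ → ℝ} (hf : ContDiffOn ℝ 1 f strip)
    (hin : IsInward f) {x : ℝ × ℝ} (hx : x ∈ strip) (hmax : IsLocalMaxOn f strip x) :
    IsCritical f x := by
  rw [isCritical_iff hf hx]
  have hd := ((hf.differentiableOn one_ne_zero) x hx).hasFDerivWithinAt
  have key : ∀ v : ℝ × ℝ, x + v ∈ strip →
      v.1 * (grad f x).1 + v.2 * (grad f x).2 ≤ 0 := by
    intro v hv
    rw [← fderivWithin_apply_eq_grad]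
    exact hmax.hasFDerivWithinAt_nonpos hd
      (mem_posTangentConeAt_of_segment_subset (convex_strip.segment_subset hx hv))
  obtain ⟨q, p⟩ := x
  rw [mem_strip] at hx
  simp only at hx
  have h1 : (grad f (q, p)).1 = 0 := by
    have a := key (1, 0) (by rw [mem_strip]; simpa using hx)
    have b := key (-1, 0) (by rw [mem_strip]; simpa using hx)
    simp only at a b
    linarith
  -- Off the top edge, the direction towards that edge is admissible and gives the sign; on it, the
  -- inward condition does. The lower bound is symmetric.
  have h2 : (grad f (q, p)).2 ≤ 0 := by
    rcases hx.2.eq_or_lt with h | h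
    · rw [h]; exact (hin q).1.le
    · have a := key (0, 1 - p) (by rw [mem_strip]; simp)
      simp only at a
      nlinarith
  have h3 : 0 ≤ (grad f (q, p)).2 := by
    rcases hx.1.eq_or_lt with h | h
    · rw [← h]; exact (hin q).2.le
    · have a := key (0, -1 - p) (by rw [mem_strip]; simp)
      simp only at a
      nlinarith
  exact Prod.ext h1 (le_antisymm h2 h3)

/-! ### A retraction onto the strip -/

/-- The retraction of the plane onto the strip that clamps the second coordinate. -/
noncomputable def clamp (x : ℝ × ℝ) : ℝ × ℝ := (x.1, max (-1) (min 1 x.2))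

lemma continuous_clamp : Continuous clamp := by unfold clamp; fun_prop

lemma clamp_mem (x : ℝ × ℝ) : clamp x ∈ strip := by
  rw [mem_strip]
  simp [clamp]

lemma clamp_of_mem {x : ℝ × ℝ} (hx : x ∈ strip) : clamp x = x := by
  rw [mem_strip] at hx
  simp [clamp, hx.1, hx.2]

/-- Extends data known only on the strip to the plane, so that full neighbourhoods of boundary
points can be used. -/
lemma continuous_comp_clamp {E : Type*} [TopologicalSpace E] {g : ℝ × ℝ → E}
    (hg : ContinuousOn g strip) : Continuous fun x => g (clamp x) :=
  hg.comp_continuous continuous_clamp clamp_mem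

/-! ### Pushing a compact set along an ascending field -/

/-- If `w` is an ascending field at `y`, then all small steps along `w` from points near `y`
increase `f`. -/
lemma eventually_lt_of_ascending {f : ℝ × ℝ → ℝ} (hf : ContDiffOn ℝ 1 f strip)
    {w : ℝ × ℝ → ℝ × ℝ} (hw : Continuous w) {y : ℝ × ℝ} (hy : y ∈ strip)
    (hpos : 0 < fderivWithin ℝ f strip y (w y)) :
    ∀ᶠ z : ℝ × (ℝ × ℝ) in 𝓝 (0, y), 0 < z.1 → z.2 ∈ strip → z.2 + z.1 • w z.2 ∈ strip →
      f z.2 < f (z.2 + z.1 • w z.2) := by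
  have hG := continuous_comp_clamp (continuousOn_grad hf)
  -- The mean value theorem evaluates the gradient at an intermediate point u.1 but the field at the
  -- starting point u.2, so positivity is needed jointly near (y, y).
  set F : (ℝ × ℝ) × (ℝ × ℝ) → ℝ := fun u =>
    (w u.2).1 * (grad f (clamp u.1)).1 + (w u.2).2 * (grad f (clamp u.1)).2 with hF
  have hFc : Continuous F := by
    have h1 : Continuous fun u : (ℝ × ℝ) × (ℝ × ℝ) => grad f (clamp u.1) := hG.comp continuous_fst
    have h2 : Continuous fun u : (ℝ × ℝ) × (ℝ × ℝ) => w u.2 := hw.comp continuous_snd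
    exact (h2.fst.mul h1.fst).add (h2.snd.mul h1.snd)
  have hF0 : 0 < F (y, y) := by
    simp only [hF, clamp_of_mem hy, ← fderivWithin_apply_eq_grad]
    exact hpos
  have hev : ∀ᶠ u in 𝓝 (y, y), 0 < F u := hFc.continuousAt.eventually (lt_mem_nhds hF0)
  obtain ⟨r, hr, hball⟩ := Metric.eventually_nhds_iff_ball.1 hev
  have hstep : Continuous fun z : ℝ × (ℝ × ℝ) => z.2 + z.1 • w z.2 := by fun_prop
  have e1 : ∀ᶠ z : ℝ × (ℝ × ℝ) in 𝓝 (0, y), z.2 ∈ Metric.ball y r :=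
    continuous_snd.continuousAt.eventually (Metric.ball_mem_nhds y hr)
  have e2 : ∀ᶠ z : ℝ × (ℝ × ℝ) in 𝓝 (0, y), z.2 + z.1 • w z.2 ∈ Metric.ball y r := by
    have h : Tendsto (fun z : ℝ × (ℝ × ℝ) => z.2 + z.1 • w z.2) (𝓝 (0, y)) (𝓝 y) := by
      simpa using hstep.tendsto (0, y)
    exact h.eventually (Metric.ball_mem_nhds y hr)
  filter_upwards [e1, e2] with ⟨s, z⟩ h1 h2 hs hz hz'
  simp only at h1 h2 hs hz hz' ⊢
  obtain ⟨u, hu, hmv⟩ := domain_mvt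
    (fun x hx => ((hf.differentiableOn one_ne_zero) x hx).hasFDerivWithinAt)
    convex_strip hz hz'
  have hu1 : u ∈ strip := convex_strip.segment_subset hz hz' hu
  have hu2 : u ∈ Metric.ball y r := (convex_ball y r).segment_subset h1 h2 hu
  have hpos' := hball (u, z) (by
    rw [← ball_prod_same]
    exact ⟨hu2, h1⟩)
  simp only [hF, clamp_of_mem hu1, ← fderivWithin_apply_eq_grad] at hpos'
  rw [add_sub_cancel_left, map_smul, smul_eq_mul] at hmv
  have := mul_pos hs hpos'
  linarith

/-- Small steps along a field that points inward at the boundary do not leave the strip. -/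
lemma eventually_mem_strip {w : ℝ × ℝ → ℝ × ℝ} (hw : Continuous w) {y : ℝ × ℝ} (hy : y ∈ strip)
    (htop : y.2 = 1 → ∀ᶠ u in 𝓝 y, (w u).2 ≤ 0) (hbot : y.2 = -1 → ∀ᶠ u in 𝓝 y, 0 ≤ (w u).2) :
    ∀ᶠ z : ℝ × (ℝ × ℝ) in 𝓝 (0, y), 0 < z.1 → z.2 ∈ strip → z.2 + z.1 • w z.2 ∈ strip := by
  have hstep : Continuous fun z : ℝ × (ℝ × ℝ) => (z.2 + z.1 • w z.2).2 := by fun_prop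
  have hsnd : Tendsto (fun z : ℝ × (ℝ × ℝ) => z.2) (𝓝 (0, y)) (𝓝 y) :=
    continuous_snd.continuousAt
  rw [mem_strip] at hy
  have e1 : ∀ᶠ z : ℝ × (ℝ × ℝ) in 𝓝 (0, y), 0 < z.1 → z.2 ∈ strip →
      (z.2 + z.1 • w z.2).2 ≤ 1 := by
    rcases hy.2.eq_or_lt with h | h
    · filter_upwards [hsnd.eventually (htop h)] with z hz hs hzs
      have := mul_nonpos_of_nonneg_of_nonpos hs.le hz
      simpa using add_le_add (mem_strip.1 hzs).2 this
    · have : ∀ᶠ z : ℝ × (ℝ × ℝ) in 𝓝 (0, y), (z.2 + z.1 • w z.2).2 < 1 :=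
        hstep.continuousAt.eventually (gt_mem_nhds (by simpa using h))
      filter_upwards [this] with z hz _ _ using hz.le
  have e2 : ∀ᶠ z : ℝ × (ℝ × ℝ) in 𝓝 (0, y), 0 < z.1 → z.2 ∈ strip →
      -1 ≤ (z.2 + z.1 • w z.2).2 := by
    rcases hy.1.eq_or_lt with h | h
    · filter_upwards [hsnd.eventually (hbot h.symm)] with z hz hs hzs
      have := mul_nonneg hs.le hz
      simpa using add_le_add (mem_strip.1 hzs).1 this
    · have : ∀ᶠ z : ℝ × (ℝ × ℝ) in 𝓝 (0, y), -1 < (z.2 + z.1 • w z.2).2 :=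
        hstep.continuousAt.eventually (lt_mem_nhds (by simpa using h))
      filter_upwards [this] with z hz _ _ using hz.le
  filter_upwards [e1, e2] with z h1 h2 hs hz
  exact mem_strip.2 ⟨h2 hs hz, h1 hs hz⟩

/-- A decreasing intersection of compact preconnected sets is preconnected. -/
lemma isPreconnected_iInter_of_antitone {X : Type*} [TopologicalSpace X] [T2Space X]
    {C : ℕ → Set X} (hC : Antitone C) (hcomp : ∀ n, IsCompact (C n))
    (hconn : ∀ n, IsPreconnected (C n)) : IsPreconnected (⋂ n, C n) := by
  have hclosed : IsClosed (⋂ n, C n) := isClosed_iInter fun n => (hcomp n).isClosed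
  have hcpt : IsCompact (⋂ n, C n) := (hcomp 0).of_isClosed_subset hclosed (iInter_subset _ 0)
  rw [isPreconnected_iff_subset_of_disjoint_closed]
  intro u v hu hv huv hdisj
  have hsep : SeparatedNhds ((⋂ n, C n) ∩ u) ((⋂ n, C n) ∩ v) := by
    apply SeparatedNhds.of_isCompact_isCompact (hcpt.inter_right hu) (hcpt.inter_right hv)
    rw [disjoint_iff_inter_eq_empty, ← hdisj]
    ext x; simp; tauto
  obtain ⟨U, V, hU, hV, hsU, hsV, hUV⟩ := hsep
  have hsub : ⋂ n, C n ⊆ U ∪ V := by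
    intro x hx
    rcases huv hx with h | h
    · exact Or.inl (hsU ⟨hx, h⟩)
    · exact Or.inr (hsV ⟨hx, h⟩)
  -- By compactness a separation of the intersection already separates some `C n`.
  obtain ⟨n, hn⟩ := exists_subset_nhds_of_isCompact (directed_of_isDirected_le hC) hcomp
    (fun x hx => (hU.union hV).mem_nhds (hsub hx))
  rcases (isPreconnected_iff_subset_of_disjoint.1 (hconn n)) U V hU hV hn
    (by rw [hUV.inter_eq, inter_empty]) with h | h
  · left
    intro x hx
    rcases huv hx with h' | h'
    · exact h'
    · exact (disjoint_left.1 hUV (h (mem_iInter.1 hx n)) (hsV ⟨hx, h'⟩)).elim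
  · right
    intro x hx
    rcases huv hx with h' | h'
    · exact (disjoint_left.1 hUV (hsU ⟨hx, h'⟩) (h (mem_iInter.1 hx n))).elim
    · exact h'

/-- The gradient of `f`, cut off where `f` exceeds `h`, and extended to the plane. -/
noncomputable def ascentField (f : ℝ × ℝ → ℝ) (h : ℝ) (z : ℝ × ℝ) : ℝ × ℝ :=
  max 0 (h - f (clamp z)) • grad f (clamp z)

lemma continuous_ascentField {f : ℝ × ℝ → ℝ} (hf : ContDiffOn ℝ 1 f strip) (h : ℝ) :
    Continuous (ascentField f h) := by
  have h1 := continuous_comp_clamp hf.continuousOn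
  have h2 := continuous_comp_clamp (continuousOn_grad hf)
  exact (continuous_const.max (continuous_const.sub h1)).smul h2

/-- One small step along the cut-off gradient lifts a compact set without critical points at
level `t` strictly above the level `t`. -/
lemma eventually_lift {f : ℝ × ℝ → ℝ} (hf : ContDiffOn ℝ 1 f strip) (hin : IsInward f)
    {t h : ℝ} (hth : t < h) {C O : Set (ℝ × ℝ)} (hC : IsCompact C) (hCs : C ⊆ strip)
    (hO : IsOpen O) (hCO : C ⊆ O) (hCt : ∀ z ∈ C, t ≤ f z)
    (hcrit : ∀ z ∈ C, f z = t → grad f z ≠ 0) :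
    ∀ᶠ s : ℝ in 𝓝 0, ∀ z ∈ C, 0 < s → z + s • ascentField f h z ∈ strip ∧
      z + s • ascentField f h z ∈ O ∧ t < f (z + s • ascentField f h z) := by
  have hw := continuous_ascentField hf h
  have hgr := continuous_comp_clamp (continuousOn_grad hf)
  have key : ∀ y ∈ C, ∀ᶠ z : ℝ × (ℝ × ℝ) in 𝓝 (0, y), z.2 ∈ C → 0 < z.1 →
      z.2 + z.1 • ascentField f h z.2 ∈ strip ∧ z.2 + z.1 • ascentField f h z.2 ∈ O ∧
      t < f (z.2 + z.1 • ascentField f h z.2) := by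
    intro y hy
    have hys := hCs hy
    have hstep : Continuous fun z : ℝ × (ℝ × ℝ) => z.2 + z.1 • ascentField f h z.2 := by
      fun_prop
    have hst0 : Tendsto (fun z : ℝ × (ℝ × ℝ) => z.2 + z.1 • ascentField f h z.2)
        (𝓝 (0, y)) (𝓝 y) := by
      simpa using hstep.tendsto (0, y)
    have hyc : clamp y = y := clamp_of_mem hys
    have e1 := eventually_mem_strip hw hys
      (by
        intro h1
        have hneg : (grad f (clamp y)).2 < 0 := by
          rw [hyc, show y = (y.1, 1) from Prod.ext rfl h1]
          exact (hin y.1).1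
        filter_upwards [(continuous_snd.comp hgr).continuousAt.eventually (gt_mem_nhds hneg)]
          with u hu
        exact mul_nonpos_of_nonneg_of_nonpos (le_max_left _ _) (le_of_lt hu))
      (by
        intro h1
        have hneg : 0 < (grad f (clamp y)).2 := by
          rw [hyc, show y = (y.1, -1) from Prod.ext rfl h1]
          exact (hin y.1).2
        filter_upwards [(continuous_snd.comp hgr).continuousAt.eventually (lt_mem_nhds hneg)]
          with u hu
        exact mul_nonneg (le_max_left _ _) (le_of_lt hu))
    have e2 := hst0.eventually (hO.mem_nhds (hCO hy))
    have e3 : ∀ᶠ z : ℝ × (ℝ × ℝ) in 𝓝 (0, y), z.2 ∈ C → 0 < z.1 →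
        z.2 + z.1 • ascentField f h z.2 ∈ strip → t < f (z.2 + z.1 • ascentField f h z.2) := by
      rcases (hCt y hy).eq_or_lt with heq | hlt
      · have hpos : 0 < fderivWithin ℝ f strip y (ascentField f h y) := by
          rw [fderivWithin_apply_eq_grad, ascentField, hyc, ← heq, max_eq_right (by linarith)]
          simp only [Prod.smul_fst, Prod.smul_snd, smul_eq_mul]
          have hne := hcrit y hy heq.symm
          have : 0 < (grad f y).1 ^ 2 + (grad f y).2 ^ 2 := by
            by_contra hle
            apply hne
            have h1 := sq_nonneg (grad f y).1
            have h2 := sq_nonneg (grad f y).2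
            exact Prod.ext (pow_eq_zero_iff two_ne_zero |>.1 (by linarith))
              (pow_eq_zero_iff two_ne_zero |>.1 (by linarith))
          have := mul_pos (sub_pos.2 hth) this
          linarith
        filter_upwards [eventually_lt_of_ascending hf hw hys hpos] with z hz hzC hs hzs
        exact (hCt _ hzC).trans_lt (hz hs (hCs hzC) hzs)
      · have hfc := continuous_comp_clamp hf.continuousOn
        have : ∀ᶠ u in 𝓝 y, t < f (clamp u) :=
          hfc.continuousAt.eventually (lt_mem_nhds (by simpa [hyc] using hlt))
        filter_upwards [hst0.eventually this] with z hz _ _ hzs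
        rwa [clamp_of_mem hzs] at hz
    filter_upwards [e1, e2, e3] with z h1 h2 h3 hzC hs
    have := h1 hs (hCs hzC)
    exact ⟨this, h2, h3 hzC hs this⟩
  -- Compactness of `C` turns the local step sizes into one common step size.
  have := hC.eventually_forall_of_forall_eventually (P := fun s z => z ∈ C → 0 < s →
    z + s • ascentField f h z ∈ strip ∧ z + s • ascentField f h z ∈ O ∧
      t < f (z + s • ascentField f h z)) key
  filter_upwards [this] with s hs z hz using hs z hz hz

/-- **Mountain pass.** If two points of the strip are separated by a low line, and lie between two
very low lines, then there is a critical point between these that is not a local maximum. -/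
theorem exists_critical_not_localMax {f : ℝ × ℝ → ℝ} (hf : ContDiffOn ℝ 1 f strip)
    (hin : IsInward f) {a b q₀ L α : ℝ} {x₁ x₂ : ℝ × ℝ} (h₁ : x₁ ∈ strip) (h₂ : x₂ ∈ strip)
    (ha₁ : a < x₁.1) (h₁₀ : x₁.1 ≤ q₀) (h₀₂ : q₀ ≤ x₂.1) (h₂b : x₂.1 < b)
    (ha : ∀ p ∈ Icc (-1 : ℝ) 1, f (a, p) < L) (hb : ∀ p ∈ Icc (-1 : ℝ) 1, f (b, p) < L)
    (hα : ∀ p ∈ Icc (-1 : ℝ) 1, f (q₀, p) ≤ α) (hx₁ : α < f x₁) (hx₂ : α < f x₂)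
    (hL : ∀ q ∈ Icc x₁.1 x₂.1, ∀ p ∈ Icc (-1 : ℝ) 1, L ≤ f (q, p)) :
    ∃ x ∈ strip, a < x.1 ∧ x.1 < b ∧ IsCritical f x ∧ ¬ IsLocalMaxOn f strip x := by
  by_contra hno
  push Not at hno
  set B : Set (ℝ × ℝ) := Icc a b ×ˢ Icc (-1) 1 with hB
  have hBc : IsCompact B := isCompact_Icc.prod isCompact_Icc
  have hBs : B ⊆ strip := prod_mono (subset_univ _) subset_rfl
  set S : ℝ → Set (ℝ × ℝ) := fun t => B ∩ {x | t ≤ f x} with hS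
  have hSc : ∀ t, IsCompact (S t) := by
    intro t
    refine hBc.of_isClosed_subset ?_ inter_subset_left
    exact (hf.continuousOn.mono hBs).preimage_isClosed_of_isClosed hBc.isClosed isClosed_Ici
  have hSmono : ∀ {s t}, s ≤ t → S t ⊆ S s := fun hst x hx => ⟨hx.1, hst.trans hx.2⟩
  have hx₁B : x₁ ∈ B := ⟨⟨ha₁.le, by linarith⟩, h₁.2⟩
  have hx₂B : x₂ ∈ B := ⟨⟨by linarith, h₂b.le⟩, h₂.2⟩
  -- The minimax runs over connected sets instead of paths: limits of compact connected sets remain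
  -- connected. Every such set crosses the line `q₀`, so `J` is bounded by `α`.
  set J : Set ℝ := {t | ∃ C : Set (ℝ × ℝ), IsPreconnected C ∧ x₁ ∈ C ∧ x₂ ∈ C ∧ C ⊆ S t} with hJ
  have hJα : ∀ t ∈ J, t ≤ α := by
    rintro t ⟨C, hC, hC₁, hC₂, hCS⟩
    have himg := (hC.image Prod.fst continuous_fst.continuousOn).ordConnected.out
      (mem_image_of_mem _ hC₁) (mem_image_of_mem _ hC₂)
    obtain ⟨z, hz, hzq⟩ := himg ⟨h₁₀, h₀₂⟩
    have := hCS hz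
    have h3 := hα z.2 this.1.2
    rw [← hzq] at h3
    exact this.2.trans h3
  have hJL : L ∈ J := by
    refine ⟨Icc x₁.1 x₂.1 ×ˢ Icc (-1) 1, (isPreconnected_Icc.prod isPreconnected_Icc),
      ⟨⟨le_rfl, by linarith⟩, h₁.2⟩, ⟨⟨by linarith, le_rfl⟩, h₂.2⟩, ?_⟩
    rintro ⟨q, p⟩ ⟨hq, hp⟩
    exact ⟨⟨⟨ha₁.le.trans hq.1, hq.2.trans h₂b.le⟩, hp⟩, hL q hq p hp⟩
  have hJbdd : BddAbove J := ⟨α, hJα⟩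
  set T := sSup J with hT
  have hTα : T ≤ α := csSup_le ⟨L, hJL⟩ hJα
  have hLT : L ≤ T := le_csSup hJbdd hJL
  obtain ⟨C, hCc, hC, hC₁, hC₂, hCS⟩ : ∃ C : Set (ℝ × ℝ), IsCompact C ∧ IsPreconnected C ∧
      x₁ ∈ C ∧ x₂ ∈ C ∧ C ⊆ S T := by
    set t : ℕ → ℝ := fun n => T - 1 / ((n : ℝ) + 1) with ht
    have htT : ∀ n, t n < T := fun n => sub_lt_self _ (by positivity)
    have htmono : Monotone t := fun m n hmn =>
      sub_le_sub_left (Nat.one_div_le_one_div hmn) _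
    -- The supremum is attained: intersect the closed components of `x₁` in the superlevel sets for
    -- levels increasing to `T`.
    set D : ℕ → Set (ℝ × ℝ) := fun n => closure (connectedComponentIn (S (t n)) x₁) with hD
    have hDS : ∀ n, D n ⊆ S (t n) := fun n =>
      closure_minimal (connectedComponentIn_subset _ _) (hSc _).isClosed
    have hDc : ∀ n, IsCompact (D n) := fun n =>
      (hSc (t n)).of_isClosed_subset isClosed_closure (hDS n)
    have hDanti : Antitone D := fun m n hmn =>
      closure_mono (connectedComponentIn_mono _ (hSmono (htmono hmn)))
    have hmem : ∀ n, x₁ ∈ D n ∧ x₂ ∈ D n := by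
      intro n
      obtain ⟨s, ⟨E, hE, hE₁, hE₂, hES⟩, hs⟩ := exists_lt_of_lt_csSup ⟨L, hJL⟩ (htT n)
      have hsub := hE.subset_connectedComponentIn hE₁ (hES.trans (hSmono hs.le))
      exact ⟨subset_closure (hsub hE₁), subset_closure (hsub hE₂)⟩
    refine ⟨⋂ n, D n, (hDc 0).of_isClosed_subset (isClosed_iInter fun n => isClosed_closure)
      (iInter_subset _ 0), isPreconnected_iInter_of_antitone hDanti hDc
      (fun n => isPreconnected_connectedComponentIn.closure),
      mem_iInter.2 fun n => (hmem n).1, mem_iInter.2 fun n => (hmem n).2, ?_⟩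
    intro x hx
    have hx' := fun n => hDS n (mem_iInter.1 hx n)
    refine ⟨(hx' 0).1, ?_⟩
    have hlim : Tendsto t atTop (𝓝 T) := by
      have := (tendsto_const_nhds (x := T)).sub
        (tendsto_one_div_add_atTop_nhds_zero_nat (𝕜 := ℝ))
      rwa [sub_zero] at this
    exact le_of_tendsto' hlim fun n => (hx' n).2
  have hCs : C ⊆ strip := fun x hx => hBs (hCS hx).1
  -- On the lines `a` and `b` the function is below `L ≤ T`, so `C` avoids them.
  have hCO : C ⊆ Ioo a b ×ˢ univ := by
    rintro ⟨q, p⟩ hx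
    obtain ⟨⟨⟨h3, h4⟩, h5⟩, h6⟩ := hCS hx
    refine ⟨⟨lt_of_le_of_ne h3 ?_, lt_of_le_of_ne h4 ?_⟩, trivial⟩
    · rintro rfl
      exact absurd (ha p h5) (not_lt.2 (hLT.trans h6))
    · rintro rfl
      exact absurd (hb p h5) (not_lt.2 (hLT.trans h6))
  -- there are no critical points at level `T` on `C`
  have hcrit : ∀ z ∈ C, f z = T → grad f z ≠ 0 := by
    intro z hz hzT hz0
    have : PreconnectedSpace C := isPreconnected_iff_preconnectedSpace.1 hC
    -- If all critical points in the box are local maxima, then near such a point at level `T` all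
    -- points of `C`, where `f ≥ T`, have value exactly `T` and are local maxima too. Connectedness
    -- would put all of `C` at level `T`, against `f x₁ > T`.
    have hclopen : IsClopen {y : C | f y = T ∧ grad f y = 0} := by
      constructor
      · exact (isClosed_eq (hf.continuousOn.mono hCs).domRestrict continuous_const).inter
          (isClosed_eq ((continuousOn_grad hf).mono hCs).domRestrict continuous_const)
      · rw [isOpen_iff_mem_nhds]
        rintro ⟨y, hy⟩ ⟨hyT, hy0⟩
        simp only at hyT hy0
        have hmax : IsLocalMaxOn f strip y :=
          hno y (hCs hy) (hCO hy).1.1 (hCO hy).1.2 ((isCritical_iff hf (hCs hy)).2 hy0)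
        have hmax' : ∀ᶠ u in 𝓝 y, ∀ᶠ v in 𝓝 u, v ∈ strip → f v ≤ T := by
          rw [eventually_eventually_nhds, ← hyT]
          exact eventually_nhdsWithin_iff.1 hmax
        filter_upwards [continuous_subtype_val.continuousAt.eventually hmax'] with u hu
        have huT : f u = T := le_antisymm (hu.self_of_nhds (hCs u.2)) (hCS u.2).2
        refine ⟨huT, (isCritical_iff hf (hCs u.2)).1
          (isCritical_of_isLocalMaxOn hf hin (hCs u.2) ?_)⟩
        refine eventually_nhdsWithin_iff.2 ?_
        rw [huT]
        exact hu
    have huniv := hclopen.eq_univ ⟨⟨z, hz⟩, hzT, hz0⟩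
    have : (⟨x₁, hC₁⟩ : C) ∈ {y : C | f y = T ∧ grad f y = 0} := huniv ▸ mem_univ _
    have := this.1
    simp only at this
    linarith
  -- With this cutoff the ascent field vanishes at `x₁` and `x₂`, so a step fixes both, yet it is
  -- active at level `T < h`.
  set h := min (f x₁) (f x₂) with hh
  have hTh : T < h := hTα.trans_lt (lt_min hx₁ hx₂)
  obtain ⟨s, hs0, hs⟩ : ∃ s : ℝ, 0 < s ∧ ∀ z ∈ C, z + s • ascentField f h z ∈ strip ∧
      z + s • ascentField f h z ∈ Ioo a b ×ˢ (univ : Set ℝ) ∧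
      T < f (z + s • ascentField f h z) := by
    have hev := eventually_lift hf hin hTh hCc hCs (isOpen_Ioo.prod isOpen_univ) hCO
      (fun z hz => (hCS hz).2) hcrit
    obtain ⟨s, hs, hs0⟩ := ((hev.filter_mono nhdsWithin_le_nhds).and
      (self_mem_nhdsWithin : Ioi (0 : ℝ) ∈ 𝓝[>] 0)).exists
    exact ⟨s, hs0, fun z hz => hs z hz hs0⟩
  set η : ℝ × ℝ → ℝ × ℝ := fun z => z + s • ascentField f h z with hη
  have hηc : Continuous η := by
    have := continuous_ascentField hf h
    fun_prop
  have hη₁ : η x₁ = x₁ := by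
    simp [hη, ascentField, clamp_of_mem h₁, hh]
  have hη₂ : η x₂ = x₂ := by
    simp [hη, ascentField, clamp_of_mem h₂, hh]
  -- The lifted set joins `x₁` to `x₂` above its minimum level, which exceeds `T`: a contradiction.
  obtain ⟨z₀, hz₀, hmin⟩ := (hCc.image hηc).exists_isMinOn (f := f) ⟨_, mem_image_of_mem η hC₁⟩
    (hf.continuousOn.mono (by rintro _ ⟨z, hz, rfl⟩; exact (hs z hz).1))
  have hz₀T : T < f z₀ := by
    obtain ⟨z, hz, rfl⟩ := hz₀
    exact (hs z hz).2.2
  have hmem : f z₀ ∈ J := by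
    refine ⟨η '' C, hC.image η hηc.continuousOn, ⟨x₁, hC₁, hη₁⟩, ⟨x₂, hC₂, hη₂⟩, ?_⟩
    intro y hy
    refine ⟨?_, hmin hy⟩
    obtain ⟨z, hz, rfl⟩ := hy
    obtain ⟨h3, h4, -⟩ := hs z hz
    exact ⟨⟨h4.1.1.le, h4.1.2.le⟩, h3.2⟩
  exact absurd (le_csSup hJbdd hmem) (not_le.2 hz₀T)

/-! ### Lowering a function across barriers -/

/-- A smooth step of small slope whose transition takes place in `[0, δ]`. -/
lemma exists_step {δ : ℝ} (hδ : 0 < δ) : ∃ κ : ℝ, 0 < κ ∧ ∃ ψ : ℝ → ℝ, ContDiff ℝ 1 ψ ∧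
    (∀ t ≤ 0, ψ t = 0) ∧ (∀ t, δ ≤ t → ψ t = κ) ∧ ∀ t, |deriv ψ t| < δ := by
  have hsm : ContDiff ℝ 1 Real.smoothTransition := Real.smoothTransition.contDiff
  have hdc : Continuous (deriv Real.smoothTransition) := hsm.continuous_deriv le_rfl
  obtain ⟨M, hM⟩ := (isCompact_Icc (a := (0 : ℝ)) (b := 1)).exists_bound_of_continuousOn
    hdc.continuousOn
  have hM0 : 0 ≤ M := (norm_nonneg _).trans (hM 0 (by simp))
  have hbd : ∀ t, |deriv Real.smoothTransition t| ≤ M := by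
    intro t
    by_cases ht : t ∈ Icc (0 : ℝ) 1
    · exact hM t ht
    · have : deriv Real.smoothTransition t = 0 := by
        rw [mem_Icc, not_and_or, not_le, not_le] at ht
        rcases ht with ht | ht
        · have : Real.smoothTransition =ᶠ[𝓝 t] fun _ => 0 := by
            filter_upwards [gt_mem_nhds ht] with u hu
            exact Real.smoothTransition.zero_of_nonpos (le_of_lt hu)
          rw [this.deriv_eq, deriv_const]
        · have : Real.smoothTransition =ᶠ[𝓝 t] fun _ => 1 := by
            filter_upwards [lt_mem_nhds ht] with u hu
            exact Real.smoothTransition.one_of_one_le (le_of_lt hu)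
          rw [this.deriv_eq, deriv_const]
      rw [this, abs_zero]
      exact hM0
  -- Rescaling time by δ multiplies the slope bound `M` by 1/δ; this height leaves slope at most δ
  -- M/(M + 1) < δ.
  refine ⟨δ ^ 2 / (M + 1), by positivity,
    fun t => δ ^ 2 / (M + 1) * Real.smoothTransition (t / δ), ?_, ?_, ?_, ?_⟩
  · exact contDiff_const.mul (hsm.comp (contDiff_id.div_const δ))
  · intro t ht
    beta_reduce
    rw [Real.smoothTransition.zero_of_nonpos (div_nonpos_of_nonpos_of_nonneg ht hδ.le), mul_zero]
  · intro t ht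
    beta_reduce
    rw [Real.smoothTransition.one_of_one_le ((one_le_div hδ).2 ht), mul_one]
  · intro t
    have hd : HasDerivAt (fun t => δ ^ 2 / (M + 1) * Real.smoothTransition (t / δ))
        (δ ^ 2 / (M + 1) * (deriv Real.smoothTransition (t / δ) * (1 / δ))) t :=
      (((hsm.differentiable one_ne_zero) _).hasDerivAt.comp t
        ((hasDerivAt_id t).div_const δ)).const_mul _
    rw [hd.deriv, abs_mul, abs_mul, abs_of_pos (by positivity : 0 < δ ^ 2 / (M + 1)),
      abs_of_pos (by positivity : 0 < 1 / δ)]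
    calc δ ^ 2 / (M + 1) * (|deriv Real.smoothTransition (t / δ)| * (1 / δ))
        ≤ δ ^ 2 / (M + 1) * (M * (1 / δ)) := by gcongr; exact hbd _
      _ = δ * (M / (M + 1)) := by field_simp
      _ < δ * 1 := by
        gcongr
        rw [div_lt_one (by positivity)]
        linarith
      _ = δ := mul_one δ

/-- `φ` varies only where it is less steep than `f`. -/
def IsLessSteep (φ : ℝ → ℝ) (f : ℝ × ℝ → ℝ) : Prop :=
  ∀ q, (∀ᶠ r in 𝓝 q, φ r = φ q) ∨ ∀ p ∈ Icc (-1 : ℝ) 1, |deriv φ q| < ‖grad f (q, p)‖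

/-- The vertical line through `q` begins a barrier of width `δ`, on which the gradient has norm
at least `δ`. -/
def IsBarrier (f : ℝ × ℝ → ℝ) (δ q : ℝ) : Prop :=
  ∀ r ∈ Icc q (q + δ), ∀ p ∈ Icc (-1 : ℝ) 1, δ ≤ ‖grad f (r, p)‖

/-- Where barriers recur, there are functions less steep than `f` that climb arbitrarily high. -/
lemma exists_isLessSteep {f : ℝ × ℝ → ℝ} {δ : ℝ} (hδ : 0 < δ)
    (hbar : ∀ R, ∃ q ≥ R, IsBarrier f δ q) (H R : ℝ) :
    ∃ c ≥ H, ∃ R' ≥ R, ∃ φ : ℝ → ℝ, ContDiff ℝ 1 φ ∧ (∀ q ≤ R, φ q = 0) ∧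
      (∀ q ≥ R', φ q = c) ∧ IsLessSteep φ f := by
  obtain ⟨κ, hκ, ψ, hψ, hψ0, hψ1, hψd⟩ := exists_step hδ
  suffices h : ∀ n : ℕ, ∃ R' ≥ R, ∃ φ : ℝ → ℝ, ContDiff ℝ 1 φ ∧ (∀ q ≤ R, φ q = 0) ∧
      (∀ q ≥ R', φ q = n * κ) ∧ IsLessSteep φ f by
    obtain ⟨n, hn⟩ := exists_nat_ge (H / κ)
    exact ⟨n * κ, (div_le_iff₀ hκ).1 hn, h n⟩
  intro n
  induction n with
  | zero =>
    exact ⟨R, le_rfl, fun _ => 0, contDiff_const, fun _ _ => rfl, fun _ _ => by simp,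
      fun q => Or.inl (Eventually.of_forall fun _ => rfl)⟩
  | succ n ih =>
    obtain ⟨R', hR', φ, hφ, hφ0, hφ1, hφs⟩ := ih
    -- The next barrier lies strictly beyond `R'`, where the previous `φ` is already locally
    -- constant, so slopes never add up.
    obtain ⟨r, hr, hrb⟩ := hbar (R' + 1)
    have hψs : ContDiff ℝ 1 fun q => ψ (q - r) := hψ.comp (contDiff_id.sub contDiff_const)
    refine ⟨r + δ, by linarith, fun q => φ q + ψ (q - r), hφ.add hψs, ?_, ?_, ?_⟩
    · intro q hq
      beta_reduce
      rw [hφ0 q hq, hψ0 _ (by linarith), add_zero]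
    · intro q hq
      beta_reduce
      rw [hφ1 q (by linarith), hψ1 _ (by linarith)]
      push_cast
      ring
    · intro q
      rcases lt_or_ge q r with hqr | hqr
      · have hev : (fun s => φ s + ψ (s - r)) =ᶠ[𝓝 q] φ := by
          filter_upwards [gt_mem_nhds hqr] with s hs
          rw [hψ0 _ (by linarith), add_zero]
        rcases hφs q with h | h
        · left
          filter_upwards [hev, h] with s h1 h2
          rw [h1, h2, hψ0 _ (by linarith), add_zero]
        · right
          rwa [hev.deriv_eq]
      · have hev : ∀ᶠ s in 𝓝 q, φ s = n * κ := by
          filter_upwards [lt_mem_nhds (show R' < q by linarith)] with s hs using hφ1 s hs.le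
        rcases le_or_gt q (r + δ) with hq | hq
        · right
          intro p hp
          have : (fun s => φ s + ψ (s - r)) =ᶠ[𝓝 q] fun s => n * κ + ψ (s - r) := by
            filter_upwards [hev] with s hs
            rw [hs]
          rw [this.deriv_eq, deriv_const_add, deriv_comp_sub_const]
          exact (hψd _).trans_le (hrb q ⟨hqr, hq⟩ p hp)
        · left
          filter_upwards [hev, lt_mem_nhds hq] with s h1 h2
          rw [h1, hev.self_of_nhds, hψ1 _ (by linarith), hψ1 _ (by linarith)]

lemma contDiffOn_sub_fst {f : ℝ × ℝ → ℝ} (hf : ContDiffOn ℝ 1 f strip) {φ : ℝ → ℝ}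
    (hφ : ContDiff ℝ 1 φ) : ContDiffOn ℝ 1 (fun x => f x - φ x.1) strip :=
  hf.sub (hφ.comp contDiff_fst).contDiffOn

lemma grad_sub_fst {f : ℝ × ℝ → ℝ} (hf : ContDiffOn ℝ 1 f strip) {φ : ℝ → ℝ}
    (hφ : ContDiff ℝ 1 φ) {x : ℝ × ℝ} (hx : x ∈ strip) :
    grad (fun x => f x - φ x.1) x = grad f x - (deriv φ x.1, 0) := by
  have h1 := ((hf.differentiableOn one_ne_zero) x hx).hasFDerivWithinAt
  have h2 : HasFDerivWithinAt (fun y : ℝ × ℝ => φ y.1) _ strip x :=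
    (((hφ.differentiable one_ne_zero) x.1).hasDerivAt.hasFDerivAt.comp x
      hasFDerivAt_fst).hasFDerivWithinAt
  have h3 := (h1.sub h2).fderivWithin (uniqueDiffOn_strip x hx)
  unfold grad
  rw [show (fun x => f x - φ x.1) = f - fun y => φ y.1 from rfl, h3]
  simp

/-- Subtracting a function less steep than `f` creates no new critical points. -/
lemma isCritical_of_isLessSteep {f : ℝ × ℝ → ℝ} (hf : ContDiffOn ℝ 1 f strip) {φ : ℝ → ℝ}
    (hφ : ContDiff ℝ 1 φ) (hs : IsLessSteep φ f) {x : ℝ × ℝ}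
    (hx : IsCritical (fun x => f x - φ x.1) x)
    (hmax : ¬ IsLocalMaxOn (fun x => f x - φ x.1) strip x) :
    IsCritical f x ∧ ¬ IsLocalMaxOn f strip x := by
  have hxs := hx.1
  have hx0 := (isCritical_iff (contDiffOn_sub_fst hf hφ) hxs).1 hx
  rw [grad_sub_fst hf hφ hxs, sub_eq_zero] at hx0
  rcases hs x.1 with h | h
  · constructor
    · rw [isCritical_iff hf hxs, hx0, (show φ =ᶠ[𝓝 x.1] fun _ => φ x.1 from h).deriv_eq,
        deriv_const]
      rfl
    · intro hm
      apply hmax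
      have h' : ∀ᶠ y in 𝓝[strip] x, φ y.1 = φ x.1 :=
        (continuous_fst.continuousAt.eventually h).filter_mono nhdsWithin_le_nhds
      filter_upwards [hm, h'] with y h1 h2
      rw [h2]
      exact sub_le_sub_right h1 _
  · have := h x.2 hxs.2
    -- In the sup norm of the product, (φ', 0) has norm |φ'|, against the strict inequality.
    rw [show grad f (x.1, x.2) = _ from hx0, Prod.norm_def] at this
    simp at this

/-! ### Oscillating functions on the strip -/

/-- If `f` recurrently has two high lines separated by a low line, and recurrently has low lines
and barriers, then critical points that are not local maxima recur. -/
theorem exists_critical_not_localMax_gt {f : ℝ × ℝ → ℝ} (hf : ContDiffOn ℝ 1 f strip)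
    (hin : IsInward f) {α A δ q₁ q₀ q₂ : ℝ} (hδ : 0 < δ) (h₁₀ : q₁ ≤ q₀) (h₀₂ : q₀ ≤ q₂)
    (hlow : ∀ R, ∃ q ≥ R, ∀ p ∈ Icc (-1 : ℝ) 1, f (q, p) ≤ α)
    (hbar : ∀ R, ∃ q ≥ R, IsBarrier f δ q)
    (hspot : ∀ R, ∃ q ≥ R, (∃ p ∈ Icc (-1 : ℝ) 1, α < f (q + q₁, p)) ∧
      (∀ p ∈ Icc (-1 : ℝ) 1, f (q + q₀, p) ≤ α) ∧ (∃ p ∈ Icc (-1 : ℝ) 1, α < f (q + q₂, p)) ∧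
      ∀ r ∈ Icc (q + q₁) (q + q₂), ∀ p ∈ Icc (-1 : ℝ) 1, A ≤ f (r, p)) (R : ℝ) :
    ∃ x, R < x.1 ∧ IsCritical f x ∧ ¬ IsLocalMaxOn f strip x := by
  -- The height of `φ₁` has to be chosen before the spot is located, which is why the lower bound
  -- `A` must be uniform over spots. A height of at least `α - A + 1` brings the low lines `a` and
  -- `b` below `A`.
  obtain ⟨a, haR, ha⟩ := hlow R
  obtain ⟨c, hc, R₁, hR₁, φ₁, hφ₁, hφ₁0, hφ₁c, hφ₁s⟩ := exists_isLessSteep hδ hbar (α - A + 1) a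
  obtain ⟨q, hq, ⟨p₁, hp₁, hp₁'⟩, hmid, ⟨p₂, hp₂, hp₂'⟩, hA⟩ := hspot (R₁ - q₁ + 1)
  obtain ⟨d, hd, R₂, hR₂, φ₂, hφ₂, hφ₂0, hφ₂c, hφ₂s⟩ :=
    exists_isLessSteep hδ hbar (α - A + 1) (q + q₂ + 1)
  obtain ⟨b, hbR, hb⟩ := hlow R₂
  -- Equal to `c` at `a`, zero over the whole spot, and `d` at `b`.
  set φ : ℝ → ℝ := fun t => (c - φ₁ t) + φ₂ t with hφdef
  have hφ : ContDiff ℝ 1 φ := (contDiff_const.sub hφ₁).add hφ₂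
  have hφs : IsLessSteep φ f := by
    intro t
    rcases lt_or_ge t (q + q₂ + 1) with ht | ht
    · have hev : φ =ᶠ[𝓝 t] fun s => c - φ₁ s := by
        filter_upwards [gt_mem_nhds ht] with s hs
        rw [hφdef]
        simp only
        rw [hφ₂0 s (le_of_lt hs), add_zero]
      rcases hφ₁s t with h | h
      · left
        filter_upwards [hev, h] with s h1 h2
        rw [h1, h2, hev.self_of_nhds]
      · right
        rwa [hev.deriv_eq, deriv_const_sub, abs_neg]
    · have hev : φ =ᶠ[𝓝 t] φ₂ := by
        filter_upwards [lt_mem_nhds (show R₁ < t by linarith)] with s hs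
        rw [hφdef]
        simp only
        rw [hφ₁c s (le_of_lt hs), sub_self, zero_add]
      rcases hφ₂s t with h | h
      · left
        filter_upwards [hev, h] with s h1 h2
        rw [h1, h2, hev.self_of_nhds]
      · right
        rwa [hev.deriv_eq]
  have hφmid : ∀ t ∈ Icc (q + q₁) (q + q₂), φ t = 0 := by
    intro t ht
    simp only [hφdef]
    rw [hφ₁c t (by linarith [ht.1]), hφ₂0 t (by linarith [ht.2])]
    ring
  have hφa : φ a = c := by
    simp only [hφdef]
    rw [hφ₁0 a le_rfl, hφ₂0 a (by linarith)]
    ring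
  have hφb : φ b = d := by
    simp only [hφdef]
    rw [hφ₁c b (by linarith), hφ₂c b hbR]
    ring
  have hg := contDiffOn_sub_fst hf hφ
  have hging : IsInward fun x => f x - φ x.1 := by
    intro t
    rw [grad_sub_fst hf hφ (mem_strip.2 (by norm_num)),
      grad_sub_fst hf hφ (mem_strip.2 (by norm_num))]
    simpa using hin t
  obtain ⟨x, -, hax, -, hxc, hxm⟩ := exists_critical_not_localMax hg hging (a := a) (b := b)
    (q₀ := q + q₀) (L := A) (α := α) (x₁ := (q + q₁, p₁)) (x₂ := (q + q₂, p₂))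
    ⟨trivial, hp₁⟩ ⟨trivial, hp₂⟩ (show a < q + q₁ by linarith)
    (show q + q₁ ≤ q + q₀ by linarith) (show q + q₀ ≤ q + q₂ by linarith)
    (show q + q₂ < b by linarith)
    (fun p hp => by simp only [hφa]; linarith [ha p hp])
    (fun p hp => by simp only [hφb]; linarith [hb p hp])
    (fun p hp => by
      simp only [hφmid (q + q₀) ⟨by linarith, by linarith⟩, sub_zero]
      exact hmid p hp)
    (by simpa only [hφmid (q + q₁) ⟨by linarith, by linarith⟩, sub_zero] using hp₁')
    (by simpa only [hφmid (q + q₂) ⟨by linarith, by linarith⟩, sub_zero] using hp₂')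
    (fun r hr p hp => by
      simp only [hφmid r hr, sub_zero]
      exact hA r hr p hp)
  exact ⟨x, haR.trans_lt hax, isCritical_of_isLessSteep hf hφ hφs hxc hxm⟩

/-- If high and low lines recur, then so do local maxima. -/
theorem exists_criticalMax_gt {f : ℝ × ℝ → ℝ} (hf : ContDiffOn ℝ 1 f strip)
    (hin : IsInward f) {α : ℝ}
    (hlow : ∀ R, ∃ q ≥ R, ∀ p ∈ Icc (-1 : ℝ) 1, f (q, p) ≤ α)
    (hhigh : ∀ R, ∃ q ≥ R, ∃ p ∈ Icc (-1 : ℝ) 1, α < f (q, p)) (R : ℝ) :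
    ∃ x, R < x.1 ∧ IsCriticalMax f x := by
  obtain ⟨a, haR, ha⟩ := hlow R
  obtain ⟨q, hq, p, hp, hqp⟩ := hhigh a
  obtain ⟨b, hbR, hb⟩ := hlow q
  have hBs : Icc a b ×ˢ Icc (-1 : ℝ) 1 ⊆ strip := prod_mono (subset_univ _) subset_rfl
  obtain ⟨⟨r, s⟩, ⟨hr, hs⟩, hmax⟩ := (isCompact_Icc.prod isCompact_Icc).exists_isMaxOn
    (f := f) ⟨(q, p), (⟨hq, hbR⟩ : q ∈ Icc a b), hp⟩ (hf.continuousOn.mono hBs)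
  have hαr : α < f (r, s) := hqp.trans_le (hmax ⟨(⟨hq, hbR⟩ : q ∈ Icc a b), hp⟩)
  have har : a < r := lt_of_le_of_ne hr.1 (by rintro rfl; exact absurd (ha s hs) (not_le.2 hαr))
  have hrb : r < b := lt_of_le_of_ne hr.2 (by rintro rfl; exact absurd (hb s hs) (not_le.2 hαr))
  have hloc : IsLocalMaxOn f strip (r, s) := by
    have : ∀ᶠ y : ℝ × ℝ in 𝓝 (r, s), y.1 ∈ Ioo a b :=
      continuous_fst.continuousAt.eventually (Ioo_mem_nhds har hrb)
    filter_upwards [this.filter_mono nhdsWithin_le_nhds, self_mem_nhdsWithin] with y h1 h2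
    exact hmax ⟨⟨h1.1.le, h1.2.le⟩, h2.2⟩
  exact ⟨(r, s), haR.trans_lt har, isCritical_of_isLocalMaxOn hf hin ⟨trivial, hs⟩ hloc, hloc⟩

/-- If all lines through a dense set contain a critical point, then all lines do. -/
theorem hasContinuum_of_dense {f : ℝ × ℝ → ℝ} (hf : ContDiffOn ℝ 1 f strip) {D : Set ℝ}
    (hD : Dense D) (h : ∀ q ∈ D, ∃ p, IsCritical f (q, p)) :
    HasContinuumOfCriticalPoints f := by
  have hclosed : IsClosed {x ∈ strip | grad f x = 0} :=
    (continuousOn_grad hf).preimage_isClosed_of_isClosed isClosed_strip isClosed_singleton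
  suffices h' : ∀ q, ∃ p, IsCritical f (q, p) by
    choose a ha using h'
    exact ⟨a, ha⟩
  -- Projection along the compact factor [-1, 1] is a closed map.
  have hproj : IsClosed {q : ℝ | ∃ p ∈ Icc (-1 : ℝ) 1, grad f (q, p) = 0} := by
    have hc2 : IsClosed {x : ℝ × Icc (-1 : ℝ) 1 | ((x.1, (x.2 : ℝ)) : ℝ × ℝ) ∈
        {x ∈ strip | grad f x = 0}} := hclosed.preimage (by fun_prop)
    convert isClosedMap_fst_of_compactSpace _ hc2 using 1
    ext q
    constructor
    · rintro ⟨p, hp, h0⟩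
      exact ⟨(q, ⟨p, hp⟩), ⟨⟨trivial, hp⟩, h0⟩, rfl⟩
    · rintro ⟨⟨q', p⟩, ⟨-, h0⟩, rfl⟩
      exact ⟨p, p.2, h0⟩
  have hall := hproj.closure_subset_iff.2 (fun q hq => by
    obtain ⟨p, hp⟩ := h q hq
    exact ⟨p, hp.1.2, (isCritical_iff hf hp.1).1 hp⟩)
  intro q
  obtain ⟨p, hp, h0⟩ := hall (hD q)
  exact ⟨p, (isCritical_iff hf ⟨trivial, hp⟩).2 h0⟩

/-- If the maximum over the vertical lines through a dense set does not depend on the line, then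
all lines contain a critical point. -/
theorem hasContinuum_of_const {f : ℝ × ℝ → ℝ} (hf : ContDiffOn ℝ 1 f strip) (hin : IsInward f)
    {D : Set ℝ} (hD : Dense D) {c : ℝ} (hle : ∀ q ∈ D, ∀ p ∈ Icc (-1 : ℝ) 1, f (q, p) ≤ c)
    (hge : ∀ q ∈ D, ∃ p ∈ Icc (-1 : ℝ) 1, c ≤ f (q, p)) :
    HasContinuumOfCriticalPoints f := by
  have hle' : ∀ x ∈ strip, f x ≤ c := by
    rintro ⟨q, p⟩ hx
    have hcl : IsClosed {r : ℝ | f (r, p) ≤ c} := by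
      refine isClosed_le (hf.continuousOn.comp_continuous (by fun_prop) fun r => ?_)
        continuous_const
      exact ⟨trivial, hx.2⟩
    exact hcl.closure_subset_iff.2 (fun r hr => hle r hr p hx.2) (hD q)
  refine hasContinuum_of_dense hf hD fun q hq => ?_
  obtain ⟨p, hp, hc⟩ := hge q hq
  refine ⟨p, isCritical_of_isLocalMaxOn hf hin ⟨trivial, hp⟩ ?_⟩
  filter_upwards [self_mem_nhdsWithin] with y hy using (hle' y hy).trans hc

lemma HasContinuumOfCriticalPoints.infinite {f : ℝ × ℝ → ℝ}
    (h : HasContinuumOfCriticalPoints f) : {x | IsCritical f x}.Infinite := by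
  obtain ⟨a, ha⟩ := h
  exact infinite_of_injective_forall_mem (f := fun q : ℝ => (q, a q))
    (fun q r hqr => (Prod.ext_iff.1 hqr).1) ha

lemma infinite_of_forall_exists_fst_gt {S : Set (ℝ × ℝ)} (h : ∀ R : ℝ, ∃ x, R < x.1 ∧ x ∈ S) :
    S.Infinite := by
  refine Infinite.of_image Prod.fst (infinite_of_forall_exists_gt fun R => ?_)
  obtain ⟨x, hx, hxS⟩ := h R
  exact ⟨x.1, mem_image_of_mem _ hxS, hx⟩

/-! ### Recurrence -/

lemma IsInvariantErgodic.isProbabilityMeasure {Ω : Type*} [TopologicalSpace Ω] [MeasurableSpace Ω]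
    {τ : Flow ℝ Ω} {P : Measure Ω} (hP : IsInvariantErgodic τ P) : IsProbabilityMeasure P :=
  ⟨hP.prob⟩

lemma IsInvariantErgodic.measurePreserving {Ω : Type*} [TopologicalSpace Ω] [MeasurableSpace Ω]
    [BorelSpace Ω] {τ : Flow ℝ Ω} {P : Measure Ω} (hP : IsInvariantErgodic τ P) (a : ℝ) :
    MeasurePreserving (τ a) P P := by
  have hm : Measurable (τ a) := (τ.continuous_toFun a).measurable
  refine ⟨hm, Measure.ext fun A hA => ?_⟩
  rw [Measure.map_apply hm hA, ← hP.invariant (-a) A hA, Flow.image_eq_preimage_symm, neg_neg]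

/-- Almost surely, the orbit enters a measurable set of positive probability at arbitrarily large
times. -/
theorem IsInvariantErgodic.recurrent {Ω : Type*} [MetricSpace Ω] [TopologicalSpace.SeparableSpace Ω]
    [MeasurableSpace Ω] [BorelSpace Ω] {τ : Flow ℝ Ω} {P : Measure Ω}
    (hP : IsInvariantErgodic τ P) {B : Set Ω}
    (hB : MeasurableSet B) (hpos : P B ≠ 0) : ∀ᵐ ω ∂P, ∀ R : ℝ, ∃ q ≥ R, τ q ω ∈ B := by
  have : SecondCountableTopology Ω := UniformSpace.secondCountable_of_separable Ω
  have := hP.isProbabilityMeasure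
  have hjoint : Measurable fun x : Ω × ℝ => τ x.2 x.1 :=
    (τ.continuous continuous_snd continuous_fst).measurable
  set V : ℝ → Ω → Set ℝ := fun R ω => {q | R ≤ q ∧ τ q ω ∈ B} with hV
  -- Asking for positive Lebesgue measure of visiting times, rather than one visit, makes the event
  -- measurable by Fubini. By invariance all `A n` have equal probability, so their decreasing,
  -- flow-invariant intersection is not null.
  set A : ℕ → Set Ω := fun n => {ω | volume (V n ω) ≠ 0} with hA
  have hAm : ∀ n, MeasurableSet (A n) := by
    intro n
    have hS : MeasurableSet {x : Ω × ℝ | (n : ℝ) ≤ x.2 ∧ τ x.2 x.1 ∈ B} :=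
      (measurableSet_le measurable_const measurable_snd).inter (hjoint hB)
    exact (measurable_measure_prodMk_left (ν := volume) hS) (measurableSet_singleton 0).compl
  have hVmono : ∀ {R S : ℝ} ω, R ≤ S → V S ω ⊆ V R ω := fun ω h q hq => ⟨h.trans hq.1, hq.2⟩
  have hVshift : ∀ R a ω, volume (V R (τ a ω)) = volume (V (R + a) ω) := by
    intro R a ω
    rw [← measure_preimage_add_right volume a (V (R + a) ω)]
    congr 1
    ext q
    simp only [hV, mem_ofPred_eq, mem_preimage, add_le_add_iff_right, τ.map_add]
  have hAanti : Antitone A := by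
    intro m n hmn ω hω h0
    exact hω (measure_mono_null (hVmono ω (Nat.cast_le.2 hmn)) h0)
  have hA0 : P (A 0) ≠ 0 := by
    intro h0
    have h1 : ∀ᵐ ω ∂P, ∀ᵐ q ∂(volume.restrict (Ici (0 : ℝ))), τ q ω ∉ B := by
      rw [measure_eq_zero_iff_ae_notMem] at h0
      filter_upwards [h0] with ω hω
      rw [ae_restrict_iff' measurableSet_Ici, ae_iff]
      simp only [hA, mem_ofPred_eq, not_not] at hω
      convert hω using 2
      ext q
      simp [hV]
    have h2 : MeasurableSet {x : Ω × ℝ | τ x.2 x.1 ∉ B} := hjoint hB.compl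
    rw [Measure.ae_ae_comm h2] at h1
    have h3 : (volume.restrict (Ici (0 : ℝ))) ≠ 0 := by
      rw [Ne, Measure.restrict_eq_zero, Real.volume_Ici]
      simp
    have := (ae_neBot.2 h3)
    obtain ⟨q, hq⟩ := h1.exists
    have h4 : P (τ q ⁻¹' B) = 0 := by
      rw [measure_eq_zero_iff_ae_notMem]
      exact hq
    rw [(hP.measurePreserving q).measure_preimage hB.nullMeasurableSet] at h4
    exact hpos h4
  have hAn : ∀ n, P (A n) = P (A 0) := by
    intro n
    rw [← (hP.measurePreserving n).measure_preimage (hAm 0).nullMeasurableSet]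
    congr 1
    ext ω
    simp only [hA, mem_ofPred_eq, mem_preimage]
    rw [hVshift, Nat.cast_zero, zero_add]
  have hinter : P (⋂ n, A n) = P (A 0) := by
    have h1 := tendsto_measure_iInter_atTop (μ := P) (fun n => (hAm n).nullMeasurableSet) hAanti
      ⟨0, measure_ne_top _ _⟩
    have h2 : (fun n => P (A n)) = fun _ => P (A 0) := funext hAn
    simp only [Function.comp_def, h2] at h1
    exact tendsto_nhds_unique h1 tendsto_const_nhds
  have hinv : ∀ a : ℝ, τ a '' (⋂ n, A n) = ⋂ n, A n := by
    rw [← Flow.isInvariant_iff_image_eq]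
    intro a ω hω
    rw [mem_iInter] at hω ⊢
    intro n
    obtain ⟨m, hm⟩ := exists_nat_ge ((n : ℝ) + a)
    simp only [hA, mem_ofPred_eq, hVshift]
    exact fun h0 => hω m (measure_mono_null (hVmono ω hm) h0)
  have hone : P (⋂ n, A n) = 1 := by
    rcases hP.ergodic _ (MeasurableSet.iInter hAm) hinv with h | h
    · exact h
    · exact absurd (hinter ▸ h) hA0
  have hae : ∀ᵐ ω ∂P, ω ∈ ⋂ n, A n :=
    (prob_compl_eq_zero_iff (MeasurableSet.iInter hAm)).2 hone
  filter_upwards [hae] with ω hω R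
  obtain ⟨n, hn⟩ := exists_nat_ge R
  obtain ⟨q, hq, hqB⟩ := nonempty_of_measure_ne_zero (mem_iInter.1 hω n)
  exact ⟨q, hn.trans hq, hqB⟩

/-- Needed for barriers: gradients are controlled only almost surely, so the barrier event is merely
null measurable. A measurable subset of equal measure suffices. -/
theorem IsInvariantErgodic.recurrent₀ {Ω : Type*} [MetricSpace Ω] [TopologicalSpace.SeparableSpace Ω]
    [MeasurableSpace Ω] [BorelSpace Ω] {τ : Flow ℝ Ω} {P : Measure Ω}
    (hP : IsInvariantErgodic τ P) {B : Set Ω}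
    (hB : NullMeasurableSet B P) (hpos : P B ≠ 0) : ∀ᵐ ω ∂P, ∀ R : ℝ, ∃ q ≥ R, τ q ω ∈ B := by
  obtain ⟨B', hsub, hB', hae⟩ := hB.exists_measurable_subset_ae_eq
  rw [← measure_congr hae] at hpos
  filter_upwards [hP.recurrent hB' hpos] with ω hω R
  obtain ⟨q, hq, hqB⟩ := hω R
  exact ⟨q, hq, hsub hqB⟩

/-! ### Realizations along the flow -/

lemma realization_flow {Ω : Type*} [TopologicalSpace Ω] (τ : Flow ℝ Ω) (Kbar : Ω → ℝ → ℝ)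
    (ω : Ω) (a : ℝ) : realization τ Kbar (τ a ω) =
      fun x => realization τ Kbar ω (x + (a, 0)) := by
  ext ⟨q, p⟩
  simp [realization, τ.map_add]

open scoped Pointwise in
lemma grad_translate (f : ℝ × ℝ → ℝ) (a : ℝ) (x : ℝ × ℝ) :
    grad (fun y => f (y + (a, 0))) x = grad f (x + (a, 0)) := by
  have h : ((a, 0) : ℝ × ℝ) +ᵥ strip = strip := by
    ext ⟨q, p⟩
    rw [mem_vadd_set_iff_neg_vadd_mem]
    simp [mem_strip]
  unfold grad
  rw [fderivWithin_comp_add_right, h]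

lemma grad_realization_flow {Ω : Type*} [TopologicalSpace Ω] (τ : Flow ℝ Ω) (Kbar : Ω → ℝ → ℝ)
    (ω : Ω) (a q p : ℝ) : grad (realization τ Kbar (τ a ω)) (q, p) =
      grad (realization τ Kbar ω) (q + a, p) := by
  rw [realization_flow, grad_translate]
  simp

lemma contDiffOn_realization_flow {Ω : Type*} [TopologicalSpace Ω] {τ : Flow ℝ Ω}
    {Kbar : Ω → ℝ → ℝ} {ω : Ω} (hf : ContDiffOn ℝ 1 (realization τ Kbar ω) strip) (a : ℝ) :
    ContDiffOn ℝ 1 (realization τ Kbar (τ a ω)) strip := by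
  rw [realization_flow]
  refine hf.comp (contDiff_id.add contDiff_const).contDiffOn fun x hx => ?_
  rw [mem_strip] at hx
  simpa [mem_strip] using hx

lemma isBarrier_realization_flow {Ω : Type*} [TopologicalSpace Ω] (τ : Flow ℝ Ω)
    (Kbar : Ω → ℝ → ℝ) (ω : Ω) (a δ : ℝ) :
    IsBarrier (realization τ Kbar (τ a ω)) δ 0 ↔ IsBarrier (realization τ Kbar ω) δ a := by
  constructor
  · intro h r hr p hp
    have := h (r - a) ⟨by linarith [hr.1], by linarith [hr.2]⟩ p hp
    rwa [grad_realization_flow, sub_add_cancel] at this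
  · intro h r hr p hp
    rw [grad_realization_flow]
    exact h (r + a) ⟨by linarith [hr.1], by linarith [hr.2]⟩ p hp

lemma derivWithin_eq_grad_snd {f : ℝ × ℝ → ℝ} (hf : ContDiffOn ℝ 1 f strip) (q : ℝ) {p : ℝ}
    (hp : p ∈ Icc (-1 : ℝ) 1) :
    derivWithin (fun s => f (q, s)) (Icc (-1) 1) p = (grad f (q, p)).2 := by
  have h1 : HasFDerivWithinAt f (fderivWithin ℝ f strip (q, p)) strip (q, p) :=
    ((hf.differentiableOn one_ne_zero) (q, p) ⟨trivial, hp⟩).hasFDerivWithinAt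
  have h2 : HasDerivWithinAt (fun s : ℝ => (q, s)) ((0 : ℝ), (1 : ℝ)) (Icc (-1) 1) p :=
    (hasDerivWithinAt_const p _ q).prodMk (hasDerivWithinAt_id p _)
  exact (h1.comp_hasDerivWithinAt p h2 fun s hs => ⟨trivial, hs⟩).derivWithin
    (uniqueDiffOn_Icc (by norm_num) p hp)

/-- The realization is `C¹` on the strip, with inward gradient. -/
def IsRegular (f : ℝ × ℝ → ℝ) : Prop := ContDiffOn ℝ 1 f strip ∧ IsInward f

lemma ae_isRegular {Ω : Type*} [TopologicalSpace Ω] [MeasurableSpace Ω] {τ : Flow ℝ Ω}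
    {P : Measure Ω} {Kbar : Ω → ℝ → ℝ} (hK : IsC1 τ P Kbar)
    (htop : ∀ᵐ ω ∂P, ∀ q : ℝ, derivWithin (Kbar (τ q ω)) (Icc (-1) 1) 1 < 0)
    (hbot : ∀ᵐ ω ∂P, ∀ q : ℝ, 0 < derivWithin (Kbar (τ q ω)) (Icc (-1) 1) (-1)) :
    ∀ᵐ ω ∂P, IsRegular (realization τ Kbar ω) := by
  filter_upwards [hK.contDiffOn, htop, hbot] with ω h1 h2 h3
  refine ⟨h1, fun q => ⟨?_, ?_⟩⟩
  · rw [← derivWithin_eq_grad_snd h1 q (by simp)]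
    exact h2 q
  · rw [← derivWithin_eq_grad_snd h1 q (by simp)]
    exact h3 q

/-- The exceptional null set depends on the time, so only countably many times can be treated at
once; the other lines are reached by continuity. -/
lemma ae_forall_rat_flow {Ω : Type*} [TopologicalSpace Ω] [MeasurableSpace Ω] [BorelSpace Ω]
    {τ : Flow ℝ Ω} {P : Measure Ω} (hP : IsInvariantErgodic τ P) {Q : Ω → Prop}
    (h : ∀ᵐ ω ∂P, Q ω) : ∀ᵐ ω ∂P, ∀ r : ℚ, Q (τ r ω) :=
  ae_all_iff.2 fun r => (hP.measurePreserving r).quasiMeasurePreserving.ae h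

/-! ### Measurability -/

lemma IsC1.measurable_realization {Ω : Type*} [TopologicalSpace Ω] [MeasurableSpace Ω]
    [BorelSpace Ω] {τ : Flow ℝ Ω} {P : Measure Ω} {Kbar : Ω → ℝ → ℝ} (hK : IsC1 τ P Kbar)
    {x : ℝ × ℝ} (hx : x ∈ strip) : Measurable fun ω => realization τ Kbar ω x := by
  have h : Measurable fun ω => (τ x.1 ω, (⟨x.2, hx.2⟩ : Icc (-1 : ℝ) 1)) :=
    (τ.continuous_toFun x.1).measurable.prodMk measurable_const
  exact hK.measurable.comp h

/-- Almost surely the derivative is the limit of difference quotients with step 1/n. Clamping keeps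
the first few evaluation points in the strip, where `Kbar` is measurable; at interior points it
eventually does nothing. -/
lemma IsC1.aemeasurable_fderivWithin {Ω : Type*} [TopologicalSpace Ω] [MeasurableSpace Ω]
    [BorelSpace Ω] {τ : Flow ℝ Ω} {P : Measure Ω} {Kbar : Ω → ℝ → ℝ} (hK : IsC1 τ P Kbar)
    {x : ℝ × ℝ} (hx : x.2 ∈ Ioo (-1 : ℝ) 1) (v : ℝ × ℝ) :
    AEMeasurable (fun ω => fderivWithin ℝ (realization τ Kbar ω) strip x v) P := by
  have hxs : x ∈ strip := ⟨trivial, Ioo_subset_Icc_self hx⟩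
  have hnhds : strip ∈ 𝓝 x := prod_mem_nhds univ_mem (Icc_mem_nhds hx.1 hx.2)
  set c : ℕ → ℝ := fun n => (n : ℝ) with hc
  have hcl : Tendsto (fun n => ‖c n‖) atTop atTop := by
    simpa [hc] using tendsto_natCast_atTop_atTop (R := ℝ)
  refine aemeasurable_of_tendsto_metrizable_ae atTop
    (f := fun n ω => c n • (realization τ Kbar ω (clamp (x + (c n)⁻¹ • v))
      - realization τ Kbar ω x))
    (fun n => (((hK.measurable_realization (clamp_mem _)).sub
      (hK.measurable_realization hxs)).const_smul (c n)).aemeasurable) ?_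
  filter_upwards [hK.contDiffOn] with ω hω
  have hd : HasFDerivAt (realization τ Kbar ω) (fderivWithin ℝ (realization τ Kbar ω) strip x) x :=
    ((hω.differentiableOn one_ne_zero) x hxs).hasFDerivWithinAt.hasFDerivAt hnhds
  refine (hd.lim v hcl).congr' ?_
  have hlim : Tendsto (fun n => x + (c n)⁻¹ • v) atTop (𝓝 x) := by
    have h0 : Tendsto (fun n => (c n)⁻¹) atTop (𝓝 0) := tendsto_inv_atTop_nhds_zero_nat
    simpa using (h0.smul_const v).const_add x
  filter_upwards [hlim.eventually hnhds] with n hn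
  rw [clamp_of_mem hn]

lemma IsC1.aemeasurable_grad {Ω : Type*} [TopologicalSpace Ω] [MeasurableSpace Ω]
    [BorelSpace Ω] {τ : Flow ℝ Ω} {P : Measure Ω} {Kbar : Ω → ℝ → ℝ} (hK : IsC1 τ P Kbar)
    {x : ℝ × ℝ} (hx : x.2 ∈ Ioo (-1 : ℝ) 1) :
    AEMeasurable (fun ω => grad (realization τ Kbar ω) x) P :=
  (hK.aemeasurable_fderivWithin hx _).prodMk (hK.aemeasurable_fderivWithin hx _)

/-- A closed condition that holds at the rational points of an open rectangle of the strip holds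
on the closed rectangle. -/
lemma forall_mem_of_forall_rat {T : Set ℝ} {g : ℝ × ℝ → ℝ}
    (hg : ContinuousOn g strip) (hT : IsClosed T) {a b : ℝ} (hab : a < b)
    (h : ∀ r s : ℚ, (r : ℝ) ∈ Icc a b → (s : ℝ) ∈ Ioo (-1 : ℝ) 1 → g (r, s) ∈ T) :
    ∀ r ∈ Icc a b, ∀ p ∈ Icc (-1 : ℝ) 1, g (r, p) ∈ T := by
  have hcl : IsClosed (strip ∩ g ⁻¹' T) := hg.preimage_isClosed_of_isClosed isClosed_strip hT
  have hdense : Dense (range fun x : ℚ × ℚ => ((x.1 : ℝ), (x.2 : ℝ))) :=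
    Rat.denseRange_cast.prodMap Rat.denseRange_cast
  have hsub := hdense.open_subset_closure_inter
    ((isOpen_Ioo (a := a) (b := b)).prod (isOpen_Ioo (a := (-1 : ℝ)) (b := 1)))
  have hsub' : closure (Ioo a b ×ˢ Ioo (-1 : ℝ) 1) ⊆ strip ∩ g ⁻¹' T := by
    refine (closure_minimal hsub isClosed_closure).trans (hcl.closure_subset_iff.2 ?_)
    rintro _ ⟨⟨hr, hs⟩, ⟨⟨r, s⟩, rfl⟩⟩
    exact ⟨⟨trivial, Ioo_subset_Icc_self hs⟩, h r s (Ioo_subset_Icc_self hr) hs⟩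
  rw [closure_prod_eq, closure_Ioo hab.ne, closure_Ioo (by norm_num)] at hsub'
  intro r hr p hp
  exact (hsub' (mk_mem_prod hr hp)).2

/-- The event that the vertical line through `0` stays below the level `α`. -/
def lowEvent {Ω : Type*} (Kbar : Ω → ℝ → ℝ) (α : ℝ) : Set Ω :=
  {ω | ∀ s : ℚ, (s : ℝ) ∈ Ioo (-1 : ℝ) 1 → Kbar ω s ≤ α}

/-- The event tests only rational interior points, for measurability; continuity recovers the closed
line. -/
lemma mem_lowEvent_iff {Ω : Type*} [TopologicalSpace Ω] {τ : Flow ℝ Ω} {Kbar : Ω → ℝ → ℝ} {ω : Ω}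
    (hf : ContinuousOn (realization τ Kbar ω) strip) (q α : ℝ) :
    τ q ω ∈ lowEvent Kbar α ↔ ∀ p ∈ Icc (-1 : ℝ) 1, realization τ Kbar ω (q, p) ≤ α := by
  constructor
  · intro h
    have hg : ContinuousOn (fun p => realization τ Kbar ω (q, p)) (Icc (-1 : ℝ) 1) :=
      hf.comp (by fun_prop) fun p hp => ⟨trivial, hp⟩
    have hcl := hg.preimage_isClosed_of_isClosed isClosed_Icc (isClosed_Iic (a := α))
    have hsub := Rat.isDenseEmbedding_coe_real.dense.open_subset_closure_inter
      (isOpen_Ioo (a := (-1 : ℝ)) (b := 1))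
    have hsub' := (closure_minimal hsub isClosed_closure).trans (hcl.closure_subset_iff.2 (by
      rintro _ ⟨hs, ⟨s, rfl⟩⟩
      exact ⟨Ioo_subset_Icc_self hs, h s hs⟩))
    rw [closure_Ioo (by norm_num)] at hsub'
    exact fun p hp => (hsub' hp).2
  · intro h s hs
    exact h s (Ioo_subset_Icc_self hs)

lemma lowEvent_mono {Ω : Type*} (Kbar : Ω → ℝ → ℝ) : Monotone (lowEvent Kbar) :=
  fun _ _ hαβ _ hω s hs => (hω s hs).trans hαβ

lemma IsC1.measurableSet_lowEvent {Ω : Type*} [TopologicalSpace Ω] [MeasurableSpace Ω]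
    [BorelSpace Ω] {τ : Flow ℝ Ω} {P : Measure Ω} {Kbar : Ω → ℝ → ℝ} (hK : IsC1 τ P Kbar)
    (α : ℝ) : MeasurableSet (lowEvent Kbar α) := by
  have : lowEvent Kbar α = ⋂ s : ℚ, {ω | (s : ℝ) ∈ Ioo (-1 : ℝ) 1 → Kbar ω s ≤ α} := by
    ext; simp [lowEvent]
  rw [this]
  refine MeasurableSet.iInter fun s => ?_
  by_cases hs : (s : ℝ) ∈ Ioo (-1 : ℝ) 1
  · simp only [hs, true_imp_iff]
    have := hK.measurable_realization (x := (0, (s : ℝ))) ⟨trivial, Ioo_subset_Icc_self hs⟩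
    simp only [realization, τ.map_zero_apply] at this
    exact measurableSet_le this measurable_const
  · simp [hs]

/-- The event that a barrier of width `δ` begins at `0`. -/
def barrierEvent {Ω : Type*} [TopologicalSpace Ω] (τ : Flow ℝ Ω) (Kbar : Ω → ℝ → ℝ) (δ : ℝ) :
    Set Ω :=
  {ω | ∀ r s : ℚ, (r : ℝ) ∈ Icc 0 δ → (s : ℝ) ∈ Ioo (-1 : ℝ) 1 →
    δ ≤ ‖grad (realization τ Kbar ω) (r, s)‖}

lemma isBarrier_of_mem_barrierEvent {Ω : Type*} [TopologicalSpace Ω] {τ : Flow ℝ Ω}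
    {Kbar : Ω → ℝ → ℝ} {ω : Ω} (hf : ContDiffOn ℝ 1 (realization τ Kbar ω) strip) {δ : ℝ}
    (hδ : 0 < δ) (h : ω ∈ barrierEvent τ Kbar δ) : IsBarrier (realization τ Kbar ω) δ 0 := by
  unfold IsBarrier
  rw [zero_add]
  exact forall_mem_of_forall_rat (continuousOn_grad hf).norm isClosed_Ici hδ h

lemma IsC1.nullMeasurableSet_barrierEvent {Ω : Type*} [TopologicalSpace Ω] [MeasurableSpace Ω]
    [BorelSpace Ω] {τ : Flow ℝ Ω} {P : Measure Ω} {Kbar : Ω → ℝ → ℝ} (hK : IsC1 τ P Kbar)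
    (δ : ℝ) : NullMeasurableSet (barrierEvent τ Kbar δ) P := by
  have : barrierEvent τ Kbar δ = ⋂ (r : ℚ) (s : ℚ), {ω | (r : ℝ) ∈ Icc 0 δ →
      (s : ℝ) ∈ Ioo (-1 : ℝ) 1 → δ ≤ ‖grad (realization τ Kbar ω) (r, s)‖} := by
    ext; simp [barrierEvent]
  rw [this]
  refine NullMeasurableSet.iInter fun r => NullMeasurableSet.iInter fun s => ?_
  by_cases hr : (r : ℝ) ∈ Icc 0 δ
  · by_cases hs : (s : ℝ) ∈ Ioo (-1 : ℝ) 1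
    · simp only [hs, hr, true_imp_iff]
      exact nullMeasurableSet_le aemeasurable_const (hK.aemeasurable_grad hs).norm
    · simp [hs]
  · simp [hr]

lemma exists_isCritical_of_not_isBarrier {f : ℝ × ℝ → ℝ} (hf : ContDiffOn ℝ 1 f strip)
    (h : ∀ n : ℕ, ¬ IsBarrier f (1 / ((n : ℝ) + 1)) 0) : ∃ p, IsCritical f (0, p) := by
  simp only [IsBarrier, not_forall, not_le] at h
  choose r hr p hp hlt using h
  have hle : ∀ n : ℕ, 1 / ((n : ℝ) + 1) ≤ 1 := fun n => by
    rw [div_le_one (by positivity)]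
    linarith [n.cast_nonneg (α := ℝ)]
  obtain ⟨x, hx, φ, hφ, hlim⟩ := (isCompact_Icc.prod isCompact_Icc).tendsto_subseq
    (s := Icc (0 : ℝ) 1 ×ˢ Icc (-1 : ℝ) 1) (x := fun n => (r n, p n))
    (fun n => ⟨⟨(hr n).1, by linarith [(hr n).2, hle n]⟩, hp n⟩)
  have hxs : x ∈ strip := ⟨trivial, hx.2⟩
  have h0 : Tendsto (fun n => 1 / (((φ n : ℕ) : ℝ) + 1)) atTop (𝓝 0) :=
    tendsto_one_div_add_atTop_nhds_zero_nat.comp hφ.tendsto_atTop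
  have hx1 : x.1 = 0 := by
    refine tendsto_nhds_unique ((continuous_fst.tendsto x).comp hlim) ?_
    exact squeeze_zero (fun n => (hr (φ n)).1) (fun n => by simpa using (hr (φ n)).2) h0
  have hg : Tendsto (fun n => ‖grad f (r (φ n), p (φ n))‖) atTop (𝓝 ‖grad f x‖) := by
    refine ((continuousOn_grad hf).norm x hxs).tendsto.comp (tendsto_nhdsWithin_iff.2
      ⟨hlim, Eventually.of_forall fun n => ⟨trivial, hp _⟩⟩)
  have hg0 : ‖grad f x‖ = 0 := tendsto_nhds_unique hg
    (squeeze_zero (fun n => norm_nonneg _) (fun n => (hlt (φ n)).le) h0)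
  refine ⟨x.2, ?_⟩
  rw [← hx1]
  exact (isCritical_iff hf hxs).2 (norm_eq_zero.1 hg0)

/-! ### The two alternatives -/

lemma exists_rat_of_eventually {x : ℝ} {Q : ℝ → Prop} (h : ∀ᶠ y in 𝓝 x, Q y) : ∃ r : ℚ, Q r :=
  Rat.denseRange_cast.mem_nhds h

/-- If almost surely the line through `0` contains a critical point, then almost surely all lines
do. -/
lemma ae_hasContinuum_of_ae_isCritical {Ω : Type*} [TopologicalSpace Ω] [MeasurableSpace Ω]
    [BorelSpace Ω] {τ : Flow ℝ Ω} {P : Measure Ω} (hP : IsInvariantErgodic τ P)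
    {Kbar : Ω → ℝ → ℝ} (hreg : ∀ᵐ ω ∂P, IsRegular (realization τ Kbar ω))
    (h : ∀ᵐ ω ∂P, ∃ p, IsCritical (realization τ Kbar ω) (0, p)) :
    ∀ᵐ ω ∂P, HasContinuumOfCriticalPoints (realization τ Kbar ω) := by
  filter_upwards [hreg, ae_forall_rat_flow hP hreg, ae_forall_rat_flow hP h] with ω h1 h2 h3
  refine hasContinuum_of_dense h1.1 Rat.isDenseEmbedding_coe_real.dense ?_
  rintro _ ⟨q, rfl⟩
  obtain ⟨p, hp⟩ := h3 q
  refine ⟨p, (isCritical_iff h1.1 (x := ((q : ℝ), p)) ⟨trivial, hp.1.2⟩).2 ?_⟩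
  have := (isCritical_iff (h2 q).1 hp.1).1 hp
  rwa [grad_realization_flow, zero_add] at this

/-- If each event that the line through `0` is low has probability zero or one, then almost surely
all lines contain a critical point. -/
lemma ae_hasContinuum_of_lowEvent_trivial {Ω : Type*} [TopologicalSpace Ω] [MeasurableSpace Ω]
    [BorelSpace Ω] {τ : Flow ℝ Ω} {P : Measure Ω} (hP : IsInvariantErgodic τ P)
    {Kbar : Ω → ℝ → ℝ} (hreg : ∀ᵐ ω ∂P, IsRegular (realization τ Kbar ω))
    (h : ∀ α, P (lowEvent Kbar α) = 0 ∨ P (lowEvent Kbar α)ᶜ = 0) :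
    ∀ᵐ ω ∂P, HasContinuumOfCriticalPoints (realization τ Kbar ω) := by
  have := hP.isProbabilityMeasure
  have hmem : ∀ {ω}, IsRegular (realization τ Kbar ω) → ∀ α,
      (ω ∈ lowEvent Kbar α ↔ ∀ p ∈ Icc (-1 : ℝ) 1, realization τ Kbar ω (0, p) ≤ α) := by
    intro ω hω α
    rw [← mem_lowEvent_iff hω.1.continuousOn, τ.map_zero_apply]
  have hline : ∀ {ω}, IsRegular (realization τ Kbar ω) →
      ContinuousOn (fun p => realization τ Kbar ω (0, p)) (Icc (-1 : ℝ) 1) := fun hω =>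
    hω.1.continuousOn.comp (by fun_prop) fun p hp => ⟨trivial, hp⟩
  set Z : Set ℝ := {α | P (lowEvent Kbar α) = 0} with hZ
  have hnot : ∀ {α}, α ∈ Z → ∀ᵐ ω ∂P, ω ∉ lowEvent Kbar α := fun hα =>
    measure_eq_zero_iff_ae_notMem.1 hα
  have hin : ∀ {α}, α ∉ Z → ∀ᵐ ω ∂P, ω ∈ lowEvent Kbar α := fun {α} hα =>
    (h α).resolve_left hα
  have hZne : Z.Nonempty := by
    by_contra hne
    rw [not_nonempty_iff_eq_empty] at hne
    have hall : ∀ᵐ ω ∂P, ∀ n : ℕ, ω ∈ lowEvent Kbar (-n) :=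
      ae_all_iff.2 fun n => hin (by rw [hne]; exact notMem_empty _)
    obtain ⟨ω, hω, hωr⟩ := (hall.and hreg).exists
    obtain ⟨n, hn⟩ := exists_nat_gt (-(realization τ Kbar ω (0, 0)))
    linarith [(hmem hωr _).1 (hω n) 0 (by simp)]
  have hZbdd : BddAbove Z := by
    by_contra hb
    rw [not_bddAbove_iff] at hb
    have hall : ∀ᵐ ω ∂P, ∀ n : ℕ, ω ∉ lowEvent Kbar n := by
      refine ae_all_iff.2 fun n => ?_
      obtain ⟨α, hα, hn⟩ := hb n
      filter_upwards [hnot hα] with ω hω hω'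
      exact hω (lowEvent_mono Kbar hn.le hω')
    obtain ⟨ω, hω, hωr⟩ := (hall.and hreg).exists
    obtain ⟨M, hM⟩ := isCompact_Icc.bddAbove_image (hline hωr)
    obtain ⟨n, hn⟩ := exists_nat_gt M
    exact hω n ((hmem hωr _).2 fun p hp => (hM (mem_image_of_mem _ hp)).trans hn.le)
  set c := sSup Z with hc
  have hup : ∀ᵐ ω ∂P, ∀ n : ℕ, ω ∈ lowEvent Kbar (c + 1 / ((n : ℝ) + 1)) := by
    refine ae_all_iff.2 fun n => hin fun hn => ?_
    have := le_csSup hZbdd hn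
    have hpos : 0 < 1 / ((n : ℝ) + 1) := by positivity
    linarith
  have hdown : ∀ᵐ ω ∂P, ∀ n : ℕ, ω ∉ lowEvent Kbar (c - 1 / ((n : ℝ) + 1)) := by
    refine ae_all_iff.2 fun n => ?_
    obtain ⟨α, hα, hlt⟩ := exists_lt_of_lt_csSup hZne
      (sub_lt_self c (by positivity : 0 < 1 / ((n : ℝ) + 1)))
    filter_upwards [hnot hα] with ω hω hω'
    exact hω (lowEvent_mono Kbar hlt.le hω')
  have hconst : ∀ᵐ ω ∂P, (∀ p ∈ Icc (-1 : ℝ) 1, realization τ Kbar ω (0, p) ≤ c) ∧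
      ∃ p ∈ Icc (-1 : ℝ) 1, c ≤ realization τ Kbar ω (0, p) := by
    filter_upwards [hup, hdown, hreg] with ω h1 h2 hω
    have h0 := tendsto_one_div_add_atTop_nhds_zero_nat (𝕜 := ℝ)
    constructor
    · intro p hp
      have := h0.const_add c
      rw [add_zero] at this
      exact ge_of_tendsto' this fun n => (hmem hω _).1 (h1 n) p hp
    · obtain ⟨p, hp, hmax⟩ := isCompact_Icc.exists_isMaxOn ⟨(0 : ℝ), by simp⟩ (hline hω)
      refine ⟨p, hp, ?_⟩
      have := h0.const_sub c
      rw [sub_zero] at this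
      refine le_of_tendsto' this fun n => ?_
      have h3 := h2 n
      rw [hmem hω] at h3
      push Not at h3
      obtain ⟨s, hs, hlt⟩ := h3
      exact hlt.le.trans (hmax hs)
  filter_upwards [hreg, ae_forall_rat_flow hP hconst] with ω h1 h2
  simp only [realization_flow, Prod.mk_add_mk, zero_add, add_zero] at h2
  refine hasContinuum_of_const h1.1 h1.2 Rat.isDenseEmbedding_coe_real.dense (c := c) ?_ ?_
  · rintro _ ⟨q, rfl⟩
    exact (h2 q).1
  · rintro _ ⟨q, rfl⟩
    exact (h2 q).2

/-- The event that the lines through `r₁` and `r₂` are high, that the line through `r₀` is low, and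
that the realization is bounded below by `-N` between `r₁` and `r₂`. -/
def valleyEvent {Ω : Type*} [TopologicalSpace Ω] (τ : Flow ℝ Ω) (Kbar : Ω → ℝ → ℝ) (γ : ℝ)
    (r₁ r₀ r₂ : ℚ) (N : ℕ) : Set Ω :=
  {ω | τ r₁ ω ∉ lowEvent Kbar γ ∧ τ r₀ ω ∈ lowEvent Kbar γ ∧ τ r₂ ω ∉ lowEvent Kbar γ ∧
    ∀ r s : ℚ, (r : ℝ) ∈ Icc (r₁ : ℝ) r₂ → (s : ℝ) ∈ Ioo (-1 : ℝ) 1 →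
      -(N : ℝ) ≤ realization τ Kbar ω (r, s)}

lemma IsC1.measurableSet_valleyEvent {Ω : Type*} [TopologicalSpace Ω] [MeasurableSpace Ω]
    [BorelSpace Ω] {τ : Flow ℝ Ω} {P : Measure Ω} {Kbar : Ω → ℝ → ℝ} (hK : IsC1 τ P Kbar)
    (γ : ℝ) (r₁ r₀ r₂ : ℚ) (N : ℕ) : MeasurableSet (valleyEvent τ Kbar γ r₁ r₀ r₂ N) := by
  have hlow := hK.measurableSet_lowEvent γ
  have hτ : ∀ a : ℝ, Measurable (τ a) := fun a => (τ.continuous_toFun a).measurable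
  refine (hτ r₁ hlow.compl).inter ((hτ r₀ hlow).inter ((hτ r₂ hlow.compl).inter
    (MeasurableSet.congr (s := ⋂ (r : ℚ) (s : ℚ), {ω | (r : ℝ) ∈ Icc (r₁ : ℝ) r₂ →
      (s : ℝ) ∈ Ioo (-1 : ℝ) 1 → -(N : ℝ) ≤ realization τ Kbar ω (r, s)}) ?_ ?_)))
  · refine MeasurableSet.iInter fun r => MeasurableSet.iInter fun s => ?_
    by_cases hr : (r : ℝ) ∈ Icc (r₁ : ℝ) r₂
    · by_cases hs : (s : ℝ) ∈ Ioo (-1 : ℝ) 1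
      · simp only [hr, hs, true_imp_iff]
        exact measurableSet_le measurable_const
          (hK.measurable_realization ⟨trivial, Ioo_subset_Icc_self hs⟩)
      · simp [hs]
    · simp [hr]
  · ext ω
    simp only [mem_iInter]
    rfl

/-- If high lines and low lines recur, then some valley occurs. -/
lemma exists_mem_valleyEvent {Ω : Type*} [TopologicalSpace Ω] {τ : Flow ℝ Ω} {Kbar : Ω → ℝ → ℝ}
    {ω : Ω} (hf : ContinuousOn (realization τ Kbar ω) strip) {α β γ : ℝ} (hαγ : α < γ)
    (hγβ : γ < β) (hlow : ∀ R : ℝ, ∃ q ≥ R, τ q ω ∈ lowEvent Kbar α)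
    (hhigh : ∀ R : ℝ, ∃ q ≥ R, τ q ω ∈ (lowEvent Kbar β)ᶜ) :
    ∃ (r₁ r₀ r₂ : ℚ) (N : ℕ), r₁ < r₀ ∧ r₀ < r₂ ∧ ω ∈ valleyEvent τ Kbar γ r₁ r₀ r₂ N := by
  have hopen_high : ∀ q : ℝ, τ q ω ∈ (lowEvent Kbar β)ᶜ →
      ∀ᶠ r in 𝓝 q, τ r ω ∉ lowEvent Kbar γ := by
    intro q hq
    rw [mem_compl_iff, mem_lowEvent_iff hf] at hq
    push Not at hq
    obtain ⟨p, hp, hlt⟩ := hq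
    have hc : Continuous fun r => realization τ Kbar ω (r, p) :=
      hf.comp_continuous (by fun_prop) fun r => ⟨trivial, hp⟩
    filter_upwards [hc.continuousAt.eventually (lt_mem_nhds (hγβ.trans hlt))] with r hr
    rw [mem_lowEvent_iff hf]
    exact fun h => absurd (h p hp) (not_le.2 hr)
  have hopen_low : ∀ q : ℝ, τ q ω ∈ lowEvent Kbar α → ∀ᶠ r in 𝓝 q, τ r ω ∈ lowEvent Kbar γ := by
    intro q hq
    rw [mem_lowEvent_iff hf] at hq
    have hc := continuous_comp_clamp hf
    have : ∀ᶠ r in 𝓝 q, ∀ p ∈ Icc (-1 : ℝ) 1, realization τ Kbar ω (clamp (r, p)) < γ := by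
      refine isCompact_Icc.eventually_forall_of_forall_eventually fun p hp => ?_
      refine hc.continuousAt.eventually (gt_mem_nhds ?_)
      beta_reduce
      rw [clamp_of_mem ⟨trivial, hp⟩]
      exact (hq p hp).trans_lt hαγ
    filter_upwards [this] with r hr
    rw [mem_lowEvent_iff hf]
    intro p hp
    have := hr p hp
    rw [clamp_of_mem ⟨trivial, hp⟩] at this
    exact this.le
  have hne : ∀ {q r : ℝ}, τ q ω ∈ lowEvent Kbar α → τ r ω ∈ (lowEvent Kbar β)ᶜ → q ≠ r := by
    rintro q _ hq hr rfl
    exact hr (lowEvent_mono Kbar (hαγ.trans hγβ).le hq)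
  obtain ⟨q₁, -, h₁⟩ := hhigh 0
  obtain ⟨q₀, hq₀, h₀⟩ := hlow q₁
  obtain ⟨q₂, hq₂, h₂⟩ := hhigh q₀
  -- The gaps α < γ < β leave room to move the three lines to rational positions at level `γ`.
  have h10 : q₁ < q₀ := lt_of_le_of_ne hq₀ (hne h₀ h₁).symm
  have h02 : q₀ < q₂ := lt_of_le_of_ne hq₂ (hne h₀ h₂)
  obtain ⟨r₁, hr₁, hr₁'⟩ := exists_rat_of_eventually ((hopen_high q₁ h₁).and (gt_mem_nhds h10))
  obtain ⟨r₀, hr₀, hr₀', hr₀''⟩ := exists_rat_of_eventually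
    ((hopen_low q₀ h₀).and ((lt_mem_nhds hr₁').and (gt_mem_nhds h02)))
  obtain ⟨r₂, hr₂, hr₂'⟩ := exists_rat_of_eventually ((hopen_high q₂ h₂).and (lt_mem_nhds hr₀''))
  obtain ⟨M, hM⟩ := (isCompact_Icc.prod isCompact_Icc).bddBelow_image
    (hf.mono (prod_mono (subset_univ _) subset_rfl : Icc (r₁ : ℝ) r₂ ×ˢ Icc (-1 : ℝ) 1 ⊆ strip))
  obtain ⟨N, hN⟩ := exists_nat_ge (-M)
  refine ⟨r₁, r₀, r₂, N, by exact_mod_cast hr₀', by exact_mod_cast hr₂', hr₁, hr₀, hr₂, ?_⟩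
  intro r s hr hs
  have := hM (mem_image_of_mem _ (mk_mem_prod hr (Ioo_subset_Icc_self hs)))
  linarith

/-- If barriers have positive probability and the events that the line through `0` is low are not
all trivial, then almost surely local maxima recur, and so do other critical points. -/
lemma ae_infinite_of_lowEvent_nontrivial {Ω : Type*} [MetricSpace Ω]
    [TopologicalSpace.SeparableSpace Ω] [MeasurableSpace Ω] [BorelSpace Ω] {τ : Flow ℝ Ω}
    {P : Measure Ω} (hP : IsInvariantErgodic τ P) {Kbar : Ω → ℝ → ℝ} (hK : IsC1 τ P Kbar)
    (hreg : ∀ᵐ ω ∂P, IsRegular (realization τ Kbar ω)) {α δ : ℝ}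
    (hlow : P (lowEvent Kbar α) ≠ 0) (hhigh : P (lowEvent Kbar α)ᶜ ≠ 0) (hδ : 0 < δ)
    (hbar : P (barrierEvent τ Kbar δ) ≠ 0) :
    ∀ᵐ ω ∂P, {x | IsCriticalMax (realization τ Kbar ω) x}.Infinite ∧
      {x | IsCritical (realization τ Kbar ω) x ∧
        ¬ IsLocalMaxOn (realization τ Kbar ω) strip x}.Infinite := by
  have := hP.isProbabilityMeasure
  -- Exceeding `α` with positive probability implies exceeding some larger level with positive
  -- probability.
  obtain ⟨β, hαβ, hβ⟩ : ∃ β, α < β ∧ P (lowEvent Kbar β)ᶜ ≠ 0 := by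
    by_contra hno
    push Not at hno
    apply hhigh
    have hall : ∀ᵐ ω ∂P, ∀ n : ℕ, ω ∈ lowEvent Kbar (α + 1 / ((n : ℝ) + 1)) :=
      ae_all_iff.2 fun n => hno _ (lt_add_of_pos_right α (by positivity))
    have : ∀ᵐ ω ∂P, ω ∈ lowEvent Kbar α := by
      filter_upwards [hall] with ω hω s hs
      have h0 := (tendsto_one_div_add_atTop_nhds_zero_nat (𝕜 := ℝ)).const_add α
      rw [add_zero] at h0
      exact ge_of_tendsto' h0 fun n => hω n s hs
    exact this
  obtain ⟨γ, hαγ, hγβ⟩ := exists_between hαβ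
  -- Almost every realization has a valley, and there are only countably many shapes, so one fixed
  -- shape with one fixed depth bound has positive probability and hence recurs.
  have hvalley : ∃ (r₁ r₀ r₂ : ℚ) (N : ℕ), r₁ < r₀ ∧ r₀ < r₂ ∧
      P (valleyEvent τ Kbar γ r₁ r₀ r₂ N) ≠ 0 := by
    by_contra hno
    push Not at hno
    have hall : ∀ᵐ ω ∂P, ∀ (r₁ r₀ r₂ : ℚ) (N : ℕ), r₁ < r₀ → r₀ < r₂ →
        ω ∉ valleyEvent τ Kbar γ r₁ r₀ r₂ N := by
      simp only [ae_all_iff]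
      exact fun r₁ r₀ r₂ N h1 h2 => measure_eq_zero_iff_ae_notMem.1 (hno r₁ r₀ r₂ N h1 h2)
    obtain ⟨ω, hω, hωr, h1, h2⟩ := (hall.and (hreg.and
      ((hP.recurrent (hK.measurableSet_lowEvent α) hlow).and
        (hP.recurrent (hK.measurableSet_lowEvent β).compl hβ)))).exists
    obtain ⟨r₁, r₀, r₂, N, h3, h4, h5⟩ :=
      exists_mem_valleyEvent hωr.1.continuousOn hαγ hγβ h1 h2
    exact hω r₁ r₀ r₂ N h3 h4 h5
  obtain ⟨r₁, r₀, r₂, N, h10, h02, hv⟩ := hvalley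
  filter_upwards [hreg, hP.recurrent (hK.measurableSet_lowEvent α) hlow,
    hP.recurrent (hK.measurableSet_valleyEvent γ r₁ r₀ r₂ N) hv,
    hP.recurrent₀ (hK.nullMeasurableSet_barrierEvent δ) hbar] with ω hω h1 h2 h3
  have hcont := hω.1.continuousOn
  have hlow' : ∀ R : ℝ, ∃ q ≥ R, ∀ p ∈ Icc (-1 : ℝ) 1, realization τ Kbar ω (q, p) ≤ γ := by
    intro R
    obtain ⟨q, hq, hql⟩ := h1 R
    exact ⟨q, hq, (mem_lowEvent_iff hcont q γ).1 (lowEvent_mono Kbar hαγ.le hql)⟩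
  have hbar' : ∀ R : ℝ, ∃ q ≥ R, IsBarrier (realization τ Kbar ω) δ q := by
    intro R
    obtain ⟨q, hq, hqb⟩ := h3 R
    exact ⟨q, hq, (isBarrier_realization_flow τ Kbar ω q δ).1
      (isBarrier_of_mem_barrierEvent (contDiffOn_realization_flow hω.1 q) hδ hqb)⟩
  have hspot : ∀ R : ℝ, ∃ q ≥ R,
      (∃ p ∈ Icc (-1 : ℝ) 1, γ < realization τ Kbar ω (q + r₁, p)) ∧
      (∀ p ∈ Icc (-1 : ℝ) 1, realization τ Kbar ω (q + r₀, p) ≤ γ) ∧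
      (∃ p ∈ Icc (-1 : ℝ) 1, γ < realization τ Kbar ω (q + r₂, p)) ∧
      ∀ r ∈ Icc (q + r₁) (q + r₂), ∀ p ∈ Icc (-1 : ℝ) 1,
        -(N : ℝ) ≤ realization τ Kbar ω (r, p) := by
    intro R
    obtain ⟨q, hq, ha, hb, hc, hd⟩ := h2 R
    rw [← τ.map_add, add_comm, mem_lowEvent_iff hcont] at ha hb hc
    push Not at ha hc
    refine ⟨q, hq, ha, hb, hc, ?_⟩
    have hd' := forall_mem_of_forall_rat (contDiffOn_realization_flow hω.1 q).continuousOn isClosed_Ici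
      (Rat.cast_lt.2 (h10.trans h02)) hd
    intro r hr p hp
    have := hd' (r - q) ⟨by linarith [hr.1], by linarith [hr.2]⟩ p hp
    rw [realization_flow] at this
    simpa using this
  constructor
  · refine infinite_of_forall_exists_fst_gt (exists_criticalMax_gt hω.1 hω.2 hlow' fun R => ?_)
    obtain ⟨q, hq, ha, -⟩ := hspot (R - r₁)
    exact ⟨q + r₁, by linarith, ha⟩
  · exact infinite_of_forall_exists_fst_gt (exists_critical_not_localMax_gt hω.1 hω.2 hδ
      (Rat.cast_le.2 h10.le) (Rat.cast_le.2 h02.le) hlow' hbar' hspot)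

end RandomTwist

theorem mainTheorem6 {Ω : Type*} [MetricSpace Ω] [TopologicalSpace.SeparableSpace Ω]
    [MeasurableSpace Ω] [BorelSpace Ω] (τ : Flow ℝ Ω) (P : Measure Ω)
    (hP : RandomTwist.IsInvariantErgodic τ P)
    (Kbar : Ω → ℝ → ℝ) (hK : RandomTwist.IsC1 τ P Kbar)
    (htop : ∀ᵐ ω ∂P, ∀ q : ℝ, derivWithin (Kbar (τ q ω)) (Icc (-1) 1) 1 < 0)
    (hbot : ∀ᵐ ω ∂P, ∀ q : ℝ, 0 < derivWithin (Kbar (τ q ω)) (Icc (-1) 1) (-1)) :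
    (∀ᵐ ω ∂P, {x | RandomTwist.IsCritical (RandomTwist.realization τ Kbar ω) x}.Infinite) ∧
    ((∀ᵐ ω ∂P, RandomTwist.HasContinuumOfCriticalPoints (RandomTwist.realization τ Kbar ω)) ∨
      (∀ᵐ ω ∂P,
        {x | RandomTwist.IsCriticalMax (RandomTwist.realization τ Kbar ω) x}.Infinite ∧
        {x | (RandomTwist.IsSaddle (RandomTwist.realization τ Kbar ω) x ∨
            RandomTwist.IsCriticalMin (RandomTwist.realization τ Kbar ω) x) ∧
          ¬ RandomTwist.IsCriticalMax (RandomTwist.realization τ Kbar ω) x}.Infinite)) := by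
  have hreg := RandomTwist.ae_isRegular hK htop hbot
  have hcases : (∀ᵐ ω ∂P,
      RandomTwist.HasContinuumOfCriticalPoints (RandomTwist.realization τ Kbar ω)) ∨
      (∀ᵐ ω ∂P,
        {x | RandomTwist.IsCriticalMax (RandomTwist.realization τ Kbar ω) x}.Infinite ∧
        {x | (RandomTwist.IsSaddle (RandomTwist.realization τ Kbar ω) x ∨
            RandomTwist.IsCriticalMin (RandomTwist.realization τ Kbar ω) x) ∧
          ¬ RandomTwist.IsCriticalMax (RandomTwist.realization τ Kbar ω) x}.Infinite) := by
    by_cases htriv : ∀ α, P (RandomTwist.lowEvent Kbar α) = 0 ∨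
        P (RandomTwist.lowEvent Kbar α)ᶜ = 0
    · exact Or.inl (RandomTwist.ae_hasContinuum_of_lowEvent_trivial hP hreg htriv)
    push Not at htriv
    obtain ⟨α, hlow, hhigh⟩ := htriv
    -- Widths 1/(n+1) make the absence of barriers a countable conjunction of null events.
    by_cases hbar : ∀ n : ℕ, P (RandomTwist.barrierEvent τ Kbar (1 / ((n : ℝ) + 1))) = 0
    · left
      refine RandomTwist.ae_hasContinuum_of_ae_isCritical hP hreg ?_
      have hall : ∀ᵐ ω ∂P, ∀ n : ℕ,
          ω ∉ RandomTwist.barrierEvent τ Kbar (1 / ((n : ℝ) + 1)) :=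
        ae_all_iff.2 fun n => measure_eq_zero_iff_ae_notMem.1 (hbar n)
      filter_upwards [hall, hreg] with ω hω hωr
      refine RandomTwist.exists_isCritical_of_not_isBarrier hωr.1 fun n hn => hω n ?_
      intro r s hr hs
      exact hn r (by rwa [zero_add]) s (Ioo_subset_Icc_self hs)
    · right
      push Not at hbar
      obtain ⟨n, hn⟩ := hbar
      filter_upwards [RandomTwist.ae_infinite_of_lowEvent_nontrivial hP hK hreg hlow hhigh
        (by positivity) hn] with ω hω
      refine ⟨hω.1, hω.2.mono ?_⟩
      rintro x ⟨hx, hmax⟩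
      refine ⟨?_, fun h => hmax h.2⟩
      by_cases hmin : IsLocalMinOn (RandomTwist.realization τ Kbar ω) RandomTwist.strip x
      · exact Or.inr ⟨hx, hmin⟩
      · exact Or.inl ⟨hx, hmax, hmin⟩
  refine ⟨?_, hcases⟩
  rcases hcases with h | h
  · filter_upwards [h] with ω hω using hω.infinite
  · filter_upwards [h] with ω hω using hω.1.mono fun x hx => hx.1
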